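/- **Setting.** Let $\beta>1$, $I=\{1,\dots,N\}$, and $\Psi_i(x)=\beta^{-1}U_ix+\gamma_i$ ($i\in I$) be similitudes of $\mathbb R^d$ with $U_i$ orthogonal, satisfying the open set condition, and let $F$ be the non-empty compact set with $F=\bigcup_i\Psi_i(F)$. Let $a_i$ be the fixed point of $\Psi_i$ and $Fix=\{a_i:i\in I\}$. Let $V_0$ be the set of essential fixed points, i.e. of those $x\in Fix$ for which $\Psi_i(x)=\Psi_j(y)$ for some $i\ne j$ and $y\in Fix$; put $I_{Fix}=\{i\in I: a_i\in V_0\}$ and $\Psi_{i_1,\dots,i_n}=\Psi_{i_1}\circ\dots\circ\Psi_{i_n}$. Assume that $F$ is a uniform finitely ramified (u.f.r.) fractal: $F$ is connected, $|V_0|\ge 2$, and $\Psi_{w}(F)\cap\Psi_{w'}(F)=\Psi_{w}(V_0)\cap\Psi_{w'}(V_0)$ for distinct words $w,w'\in I^n$, $n\geq 1$. Assume also the normalisation $\Psi_1(x)=\beta^{-1}x$, $0\in V_0$. An $n$-cell is a set $\Psi_{i_1,\dots,i_n}(V_0)$, and $h_n(x,y)$ is the least $k\ge 1$ for which there are $n$-cells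 $K_1,\dots,K_k$ with $x\in K_1$, $y\in K_k$ and $K_i\cap K_{i+1}\neq\emptyset$ for $1\le i<k$. Let $\mathcal Q$ be the space of real symmetric matrices $(Q_{ij})_{i,j\in I_{Fix}}$ with zero row sums, $S_Q(\xi,\xi)=-\sum_{i,j}Q_{ij}\xi_i\xi_j$ for $\xi\in\mathbb R^{I_{Fix}}$, and let $\mathcal Q_M$ (resp. $\mathrm{Int}(\mathcal Q_M)$) be the set of $Q\in\mathcal Q$ with $Q_{ij}\ge 0$ (resp. $>0$) for $i\ne j$. Let $\Xi_+$ be the (countable, discrete) set of sequences $\eta=(\eta_k)_{k\ge1}$ in $I$ that are eventually equal to $1$, let $\eta\cdot k=(k,\eta_1,\eta_2,\dots)$, and let $\pi([\eta,i])=\lim_{n}\beta^n\Psi_{\eta_n}\circ\dots\circ\Psi_{\eta_1}(a_i)$; these points, for $\eta\in\Xi_+$ and $i\in I_{Fix}$, are the vertices of the unbounded graph $\hat V=\bigcup_n\beta^n\bigcup_{w\in I^n}\Psi_w(V_0)$. For $\theta:\Xi_+\to\mathcal Q_M$, the renormalised field $\bar\Phi(\theta):\Xi_+\to\mathcal Q_M$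 is given by tracing the network onto $\beta\hat V$ cell by cell: \[ S_{\bar\Phi(\theta)(\eta)}(\xi,\xi)=\inf\Big\{\sum_{k\in I}S_{\theta(\eta\cdot k)}\big(v(\pi([\eta\cdot k,\cdot])),v(\pi([\eta\cdot k,\cdot]))\big):\ v(\beta\,\pi([\eta,i]))=\xi_i\ \ \forall i\in I_{Fix}\Big\}. \] For a constant field $\theta\equiv Q$, $\bar\Phi(\theta)$ is again constant; call its value $\tilde\Phi(Q)$. Assume that $Q_0\in\mathrm{Int}(\mathcal Q_M)$ and $\varrho>0$ satisfy $\tilde\Phi(Q_0)=\varrho^{-1}Q_0$, and set $\Phi=\varrho\bar\Phi$, with $n$-th iterate $\Phi^n$. Let $\theta$ be a random family $(\theta(\eta))_{\eta\in\Xi_+}$ in $\mathcal Q_M$, defined on a probability space with measure $\mathbf P$, such that the $\theta(\eta)$ are independent and identically distributed and, for some constant $C_1>0$, almost surely $C_1S_{Q_0}(\xi,\xi)\le S_{\theta(\eta)}(\xi,\xi)$ for all $\eta$ and $\xi$. Suppose that the conductances have at most polynomial decay at infinity: there are $c_1>0$ and $\gamma_{ij}>0$ such that \[\mathbf P(\theta(\eta)_{ij}\ge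 s)\le c_1s^{-\gamma_{ij}}\qquad\text{for all } i\neq j\in I_{Fix},\ \eta\in\Xi_+,\ s\ge 1.\] **Proposition.** (a) If there exists $n_0\ge1$ such that $h_{n_0}(x,y)\ge 2$ for all distinct $x,y\in V_0$, then there exists $m\ge 1$ (possibly different from $n_0$) such that \[\mathbf E\big[(\Phi^{m}(\theta)(\eta)_{ij})^2\big]<\infty\qquad\text{for all } i,j\in I_{Fix},\ \eta\in\Xi_+.\] (b) In particular, the conclusion of (a) holds if $F$ is a nested fractal, i.e. a u.f.r. fractal such that any two $1$-cells are joined by a chain of successively intersecting $1$-cells, and such that for all distinct $x,y\in V_0$ and all $n\ge0$ the reflection in the hyperplane $\{z:|z-x|=|z-y|\}$ maps $n$-cells to $n$-cells. -/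

import Mathlib

open MeasureTheory ProbabilityTheory Filter
open scoped Classical

noncomputable section

/-- A finite family of similitudes `Ψ_i x = β⁻¹ U_i x + γ_i` of `ℝ^d` with a common contraction
ratio `β⁻¹ < 1` and orthogonal linear parts. The index set is `Fin N`, and the index `0 : Fin N`
plays the role of the distinguished first index. -/
structure SimilitudeSystem (d N : ℕ) where
  β : ℝ
  one_lt_β : 1 < β
  U : Fin N → (EuclideanSpace ℝ (Fin d) ≃ₗᵢ[ℝ] EuclideanSpace ℝ (Fin d))
  γ : Fin N → EuclideanSpace ℝ (Fin d)

namespace SimilitudeSystem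

variable {d N : ℕ} (S : SimilitudeSystem d N)

/-- The map `Ψ_i`. -/
def Ψ (i : Fin N) (x : EuclideanSpace ℝ (Fin d)) : EuclideanSpace ℝ (Fin d) :=
  S.β⁻¹ • S.U i x + S.γ i

theorem contractingWith_Ψ (i : Fin N) : ContractingWith (Real.toNNReal S.β⁻¹) (S.Ψ i) := by
  have hβ := S.one_lt_β
  have h0 : (0 : ℝ) ≤ S.β⁻¹ := by positivity
  constructor
  · rw [Real.toNNReal_lt_one]
    exact inv_lt_one_of_one_lt₀ hβ
  · refine LipschitzWith.of_dist_le_mul fun x y => ?_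
    simp only [Ψ, dist_add_right, dist_smul₀, (S.U i).dist_map, Real.coe_toNNReal _ h0,
      Real.norm_of_nonneg h0, le_refl]

/-- The fixed point `a_i` of `Ψ_i`. -/
def a (i : Fin N) : EuclideanSpace ℝ (Fin d) :=
  ContractingWith.fixedPoint (S.Ψ i) (S.contractingWith_Ψ i)

/-- The set `Fix` of the fixed points of the maps `Ψ_i`. -/
def Fix : Set (EuclideanSpace ℝ (Fin d)) := Set.range S.a

/-- The set `V_0` of essential fixed points. -/
def V₀ : Set (EuclideanSpace ℝ (Fin d)) :=
  {x | x ∈ S.Fix ∧ ∃ i j : Fin N, i ≠ j ∧ ∃ y ∈ S.Fix, S.Ψ i x = S.Ψ j y}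

/-- The index set `I_Fix` of those maps whose fixed point is essential. -/
def IFix : Type := {i : Fin N // S.a i ∈ S.V₀}

instance : Finite S.IFix := inferInstanceAs (Finite {i : Fin N // S.a i ∈ S.V₀})

instance : Fintype S.IFix := Fintype.ofFinite _

/-- The vector space `𝒬` of symmetric matrices indexed by `I_Fix` with vanishing row sums. -/
def IsQ (Q : S.IFix → S.IFix → ℝ) : Prop :=
  (∀ i j, Q i j = Q j i) ∧ ∀ i, ∑ j, Q i j = 0

/-- The quadratic form `S_Q(ξ, ξ) = -∑_{i,j} Q_{ij} ξ_i ξ_j` of `Q ∈ 𝒬`. -/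
def form (Q : S.IFix → S.IFix → ℝ) (ξ : S.IFix → ℝ) : ℝ :=
  -∑ i, ∑ j, Q i j * ξ i * ξ j

/-- The cone `𝒬_M` of the elements of `𝒬` with non-negative off-diagonal entries. -/
def IsQM (Q : S.IFix → S.IFix → ℝ) : Prop :=
  S.IsQ Q ∧ ∀ i j, i ≠ j → 0 ≤ Q i j

/-- The set `Int(𝒬_M)` of the elements of `𝒬` with positive off-diagonal entries. -/
def IsIntQM (Q : S.IFix → S.IFix → ℝ) : Prop :=
  S.IsQ Q ∧ ∀ i j, i ≠ j → 0 < Q i j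

/-- The composition `Ψ_{i_1} ∘ ⋯ ∘ Ψ_{i_n}` for a word `[i_1, …, i_n]`. -/
def word : List (Fin N) → EuclideanSpace ℝ (Fin d) → EuclideanSpace ℝ (Fin d)
  | [] => id
  | i :: w => S.Ψ i ∘ word w

/-- The `n`-cells: the sets `Ψ_{i_1, …, i_n}(V_0)`. -/
def IsCell (n : ℕ) (K : Set (EuclideanSpace ℝ (Fin d))) : Prop :=
  ∃ w : List (Fin N), w.length = n ∧ K = S.word w '' S.V₀

/-- `x` and `y` are joined by a chain `K_0, …, K_{k-1}` of `k ≥ 1` successively intersecting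
`n`-cells, with `x ∈ K_0` and `y ∈ K_{k-1}`. -/
def IsJoinedBy (n k : ℕ) (x y : EuclideanSpace ℝ (Fin d)) : Prop :=
  1 ≤ k ∧ ∃ K : ℕ → Set (EuclideanSpace ℝ (Fin d)),
    (∀ i < k, S.IsCell n (K i)) ∧ x ∈ K 0 ∧ y ∈ K (k - 1) ∧
      ∀ i, i + 1 < k → (K i ∩ K (i + 1)).Nonempty

/-- The cell-chain distance `h_n(x, y)`: the least number of `n`-cells in a chain that joins `x`
to `y` (and `⊤` if there is no chain). -/
def h (n : ℕ) (x y : EuclideanSpace ℝ (Fin d)) : ℕ∞ :=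
  ⨅ (k : ℕ) (_ : S.IsJoinedBy n k x y), (k : ℕ∞)

end SimilitudeSystem

/-- `F` is the compact uniform finitely ramified fractal determined by `S`, with the
normalisation `Ψ_1 x = β⁻¹ x` and `0 ∈ V_0`. The clauses on `F` before its connectedness say that
`F` is the (unique) self-similar compact set of the system. -/
structure IsUFRFractal {d N : ℕ} [NeZero N] (S : SimilitudeSystem d N)
    (F : Set (EuclideanSpace ℝ (Fin d))) : Prop where
  open_set_condition : ∃ W : Set (EuclideanSpace ℝ (Fin d)),
    W.Nonempty ∧ Bornology.IsBounded W ∧ IsOpen W ∧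
      (∀ i j, i ≠ j → Disjoint (S.Ψ i '' W) (S.Ψ j '' W)) ∧ (⋃ i, S.Ψ i '' W) ⊆ W
  nonempty : F.Nonempty
  isCompact : IsCompact F
  self_similar : F = ⋃ i, S.Ψ i '' F
  isConnected : IsConnected F
  finitely_ramified : ∀ w w' : List (Fin N), w.length = w'.length → w ≠ w' →
    S.word w '' F ∩ S.word w' '' F = S.word w '' S.V₀ ∩ S.word w' '' S.V₀
  nontrivial : S.V₀.Nontrivial
  Ψ_zero : ∀ x, S.Ψ 0 x = S.β⁻¹ • x
  zero_mem : (0 : EuclideanSpace ℝ (Fin d)) ∈ S.V₀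

instance {d : ℕ} (x y : EuclideanSpace ℝ (Fin d)) :
    Nonempty (AffineSubspace.perpBisector x y) :=
  AffineSubspace.perpBisector_nonempty.to_subtype

/-- A nested fractal: a uniform finitely ramified fractal (in particular the open set condition,
the nesting axiom and `|V_0| ≥ 2` hold) which satisfies the connectivity axiom and the symmetry
axiom: for distinct `x, y ∈ V_0`, the reflection in the hyperplane of the points equidistant from
`x` and `y` maps `n`-cells to `n`-cells. -/
structure IsNestedFractal {d N : ℕ} [NeZero N] (S : SimilitudeSystem d N)
    (F : Set (EuclideanSpace ℝ (Fin d))) : Prop extends IsUFRFractal S F where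
  connectivity : ∀ K K' : Set (EuclideanSpace ℝ (Fin d)), S.IsCell 1 K → S.IsCell 1 K' →
    Relation.ReflTransGen (fun A B => S.IsCell 1 A ∧ S.IsCell 1 B ∧ (A ∩ B).Nonempty) K K'
  symmetry : ∀ x ∈ S.V₀, ∀ y ∈ S.V₀, x ≠ y → ∀ (n : ℕ) (K : Set (EuclideanSpace ℝ (Fin d))),
    S.IsCell n K →
      S.IsCell n (EuclideanGeometry.reflection (AffineSubspace.perpBisector x y) '' K)

/-- The address space `Ξ_+`: sequences which are eventually equal to the distinguished index.
The entry `η k` is the entry with number `k + 1` in the numbering that starts with `1`. -/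
def Address (N : ℕ) [NeZero N] : Type :=
  {η : ℕ → Fin N // ∃ n, ∀ k, n ≤ k → η k = 0}

namespace Address

variable {N : ℕ} [NeZero N]

/-- The constant address `(1, 1, …)`. -/
def base : Address N := ⟨fun _ => 0, 0, fun _ _ => rfl⟩

/-- The address `η · i`, with first entry `i` followed by the entries of `η`. -/
def cons (η : Address N) (i : Fin N) : Address N :=
  ⟨fun k => Nat.casesOn k i η.1, by
    obtain ⟨n, hn⟩ := η.2
    refine ⟨n + 1, fun k hk => ?_⟩
    cases k with
    | zero => omega
    | succ k => exact hn k (by omega)⟩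

end Address

namespace SimilitudeSystem

variable {d N : ℕ} [NeZero N] (S : SimilitudeSystem d N)

/-- `Ψ_{η_n} ∘ ⋯ ∘ Ψ_{η_1}`, the last entry being applied last. -/
def rev (η : ℕ → Fin N) : ℕ → EuclideanSpace ℝ (Fin d) → EuclideanSpace ℝ (Fin d)
  | 0 => id
  | n + 1 => S.Ψ (η n) ∘ rev η n

/-- The vertex `π([η, i])` of the unbounded graph with vertex set `V̂ = ⋃_n β^n V_n`, that is the
`i`-th vertex of the `0`-cell with address `η`: the (eventually constant) limit of
`β^n Ψ_{η_n}(⋯ Ψ_{η_1}(a_i))`. -/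
def vertex (η : Address N) (i : S.IFix) : EuclideanSpace ℝ (Fin d) :=
  limUnder atTop fun n : ℕ => S.β ^ n • S.rev η.1 n (S.a i.1)

/-- The renormalised energy on the `0`-cell with address `η`. The function `v` lives on the
unbounded graph and is prescribed at the points `β · π([η, i])`, that is on the vertices of the
`0`-cell with address `η` seen inside the graph magnified by `β`; the energy of `v` on the `0`-cells
with the addresses `η · k`, which fill up the magnified cell, is minimised. -/
def renormEnergy (θ : Address N → S.IFix → S.IFix → ℝ) (η : Address N) (ξ : S.IFix → ℝ) : ℝ :=
  ⨅ v : {v : EuclideanSpace ℝ (Fin d) → ℝ // ∀ i, v (S.β • S.vertex η i) = ξ i},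
    ∑ k : Fin N, S.form (θ (η.cons k)) fun j => v.1 (S.vertex (η.cons k) j)

/-- The renormalisation map `Φ̄`. The total energy `Ŝ_θ(v, v)` is half the sum of the energies of
the `0`-cells, and any two of the magnified cells meet only in points of `β V̂`, where `v` is
prescribed. So the minimisation that defines the renormalised form decouples, and `Φ̄(θ)(η)` is the
element of `𝒬` whose form is the renormalised energy on the cell with address `η`. It is
determined by this, since an element of `𝒬` is determined by its form. -/
def renorm (θ : Address N → S.IFix → S.IFix → ℝ) (η : Address N) : S.IFix → S.IFix → ℝ :=
  if h : ∃ Q, S.IsQ Q ∧ ∀ ξ, S.form Q ξ = S.renormEnergy θ η ξ then h.choose else 0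

/-- The renormalisation map `Φ̃` on `𝒬_+`: the map `Φ̄` on constant fields. -/
def renormConst (Q : S.IFix → S.IFix → ℝ) : S.IFix → S.IFix → ℝ :=
  S.renorm (fun _ => Q) Address.base

/-- The normalised renormalisation map `Φ = ϱ Φ̄`. -/
def scaledRenorm (ϱ : ℝ) (θ : Address N → S.IFix → S.IFix → ℝ) :
    Address N → S.IFix → S.IFix → ℝ :=
  ϱ • S.renorm θ

/-- `θ` is a random element of `Θ_M` (the families of elements of `𝒬_M` indexed by `Ξ_+`) under
the probability measure `P`, whose values at the different addresses are independent and
identically distributed, and bounded below by a positive multiple of `Q₀` as forms. -/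
structure IsRandomConductance {Ω : Type*} [MeasurableSpace Ω] (P : Measure Ω)
    (Q₀ : S.IFix → S.IFix → ℝ) (θ : Ω → Address N → S.IFix → S.IFix → ℝ) : Prop where
  mem : ∀ ω η, S.IsQM (θ ω η)
  measurable : ∀ η, Measurable fun ω => θ ω η
  indep : iIndepFun (fun η ω => θ ω η) P
  identDistrib : ∀ η η', IdentDistrib (fun ω => θ ω η) (fun ω => θ ω η') P P
  lower_bound : ∃ C : ℝ, 0 < C ∧ ∀ᵐ ω ∂P, ∀ η ξ, C * S.form Q₀ ξ ≤ S.form (θ ω η) ξ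

/-- For some `n₀ ≥ 1`, all entries of `Φ^{n₀}(θ)(η)` have a finite second moment. -/
def HasFiniteSecondMoments {Ω : Type*} [MeasurableSpace Ω] (P : Measure Ω) (ϱ : ℝ)
    (θ : Ω → Address N → S.IFix → S.IFix → ℝ) : Prop :=
  ∃ n₀ : ℕ, 1 ≤ n₀ ∧ ∀ (i j : S.IFix) (η : Address N),
    MemLp (fun ω => (S.scaledRenorm ϱ)^[n₀] (θ ω) η i j) 2 P

end SimilitudeSystem

end

/-! A large effective conductance needs many independent large conductances. If `Φ^m(θ)(η)_{ij} ≥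
s`, a cut argument shows that `a_i` and `a_j` are joined inside the subdivided cell by edges of
conductance at least `s / (ϱC)^m`. Otherwise the indicator of the cluster of one end would be a test
function of too small energy (`exists_path_of_le_renorm`, iterated in `exists_path_of_le_iterate`).

Such a path visits many cells. If no `n`-cell contains two points of `V_0`, a chain joining two of
them crosses at least two `n`-cells from one vertex to another. Finite ramification lets a path
change cells only at vertices, so the argument repeats inside each crossed cell. At level `kn` at
least `2^k` distinct cells occur (`cellJoined_coarse`, `two_pow_le_ncard`).

Distinct cells carry independent conductances. With `g` the least decay exponent, the tail of
`Φ^{kn}(θ)(η)_{ij}` is therefore `O(s^{-g 2^k})`, by a union bound over sets of `2^k` cells. Once `g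
2^k ≥ 3`, the second moment is finite (`memLp_two_of_exists_independent_large`).

For (b), cell diameters shrink like `β^{-n}`, so for large `n` no `n`-cell contains two points of
the finite set `V_0`, and (a) applies. -/

namespace SimilitudeSystem

/-! ### Similitudes, words and the open set condition. -/

section Geometry

variable {d N : ℕ} (S : SimilitudeSystem d N)

theorem β_pos : 0 < S.β := zero_lt_one.trans S.one_lt_β

theorem dist_Ψ (i : Fin N) (x y : EuclideanSpace ℝ (Fin d)) :
    dist (S.Ψ i x) (S.Ψ i y) = S.β⁻¹ * dist x y := by
  have h0 : (0 : ℝ) ≤ S.β⁻¹ := (inv_pos.2 S.β_pos).le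
  simp only [Ψ, dist_add_right, dist_smul₀, (S.U i).dist_map, Real.norm_of_nonneg h0]

theorem Ψ_injective (i : Fin N) : Function.Injective (S.Ψ i) := by
  intro x y h
  have h1 := S.dist_Ψ i x y
  rw [h, dist_self] at h1
  have := (inv_pos.2 S.β_pos).ne'
  exact dist_eq_zero.1 (by simpa [this] using h1.symm)

theorem Ψ_a (i : Fin N) : S.Ψ i (S.a i) = S.a i :=
  (S.contractingWith_Ψ i).fixedPoint_isFixedPt

theorem dist_word (w : List (Fin N)) (x y : EuclideanSpace ℝ (Fin d)) :
    dist (S.word w x) (S.word w y) = S.β⁻¹ ^ w.length * dist x y := by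
  induction w with
  | nil => simp [word]
  | cons i w ih =>
    simp only [word, Function.comp_apply, dist_Ψ, ih, List.length_cons, pow_succ]
    ring

theorem word_injective (w : List (Fin N)) : Function.Injective (S.word w) := by
  induction w with
  | nil => exact Function.injective_id
  | cons i w ih => exact (S.Ψ_injective i).comp ih

theorem word_append (w w' : List (Fin N)) (x : EuclideanSpace ℝ (Fin d)) :
    S.word (w ++ w') x = S.word w (S.word w' x) := by
  induction w with
  | nil => rfl
  | cons i w ih => simp only [List.cons_append, word, Function.comp_apply, ih]

theorem word_replicate_a (i : Fin N) (n : ℕ) : S.word (List.replicate n i) (S.a i) = S.a i := by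
  induction n with
  | zero => rfl
  | succ n ih => simp only [List.replicate_succ, word, Function.comp_apply, ih, Ψ_a]

theorem word_maps_of_Ψ_maps {F : Set (EuclideanSpace ℝ (Fin d))}
    (hF : ∀ i, ∀ x ∈ F, S.Ψ i x ∈ F) (w : List (Fin N)) {x : EuclideanSpace ℝ (Fin d)}
    (hx : x ∈ F) : S.word w x ∈ F := by
  induction w with
  | nil => exact hx
  | cons i w ih => exact hF i _ ih

theorem finite_V₀ : S.V₀.Finite :=
  (Set.finite_range S.a).subset fun _ hx => hx.1

open scoped Pointwise in
theorem volume_image_Ψ (i : Fin N) (s : Set (EuclideanSpace ℝ (Fin d))) :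
    volume (S.Ψ i '' s) = ENNReal.ofReal (S.β⁻¹ ^ d) * volume s := by
  have h : S.Ψ i '' s = (fun x => x + S.γ i) '' (S.β⁻¹ • (S.U i '' s)) := by
    ext x
    simp only [Set.mem_image, Set.mem_smul_set, exists_exists_and_eq_and, Ψ]
  have hU : volume (S.U i '' s) = volume s := by
    have := (S.U i).symm.measurePreserving.measure_preimage_emb
      (S.U i).symm.toHomeomorph.measurableEmbedding s
    rw [← this]
    congr 1
    ext x
    constructor
    · rintro ⟨y, hy, rfl⟩
      simpa using hy
    · intro hx
      exact ⟨_, hx, by simp⟩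
  rw [h, Set.image_add_right, measure_preimage_add_right, Measure.addHaar_smul, hU,
    abs_of_nonneg (pow_nonneg (inv_pos.2 S.β_pos).le _), finrank_euclideanSpace_fin]

/-- Under the open set condition, distinct maps have distinct fixed points: otherwise the number
of the disjoint copies of the open set of size `β⁻ⁿ` near a common fixed point is at least `2ⁿ`. -/
theorem a_injective_of_openSetCondition {W : Set (EuclideanSpace ℝ (Fin d))} (hW : W.Nonempty)
    (hb : Bornology.IsBounded W) (ho : IsOpen W)
    (hd : ∀ i j, i ≠ j → Disjoint (S.Ψ i '' W) (S.Ψ j '' W)) (hs : (⋃ i, S.Ψ i '' W) ⊆ W) :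
    Function.Injective S.a := by
  intro i j hij
  by_contra hne
  obtain ⟨R, hR⟩ := (Metric.isBounded_iff_subset_closedBall (S.a i)).1 hb
  have hβ := inv_pos.2 S.β_pos
  have hR0 : 0 ≤ R := by
    obtain ⟨x, hx⟩ := hW
    exact dist_nonneg.trans (Metric.mem_closedBall.1 (hR hx))
  have hopen : ∀ l : Fin N, ∀ D : Set (EuclideanSpace ℝ (Fin d)), IsOpen D →
      IsOpen (S.Ψ l '' D) := by
    intro l D hD
    have : S.Ψ l '' D = (fun x => S.β • (x - S.γ l)) ⁻¹' (S.U l '' D) := by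
      ext x
      simp only [Set.mem_image, Set.mem_preimage, Ψ]
      refine exists_congr fun y => and_congr_right fun _ => ?_
      constructor
      · rintro rfl
        rw [add_sub_cancel_right, smul_inv_smul₀ S.β_pos.ne']
      · intro h
        rw [h, inv_smul_smul₀ S.β_pos.ne', sub_add_cancel]
    rw [this]
    exact ((S.U l).toHomeomorph.isOpenMap D hD).preimage (by fun_prop)
  -- `D` is the union of the `2^n` images of `W` under the words of length `n` in `i` and `j`. It
  -- lies in a ball of volume proportional to `β^{-nd}`, and that factor also scales the volume of
  -- each image. Cancelling it leaves a bound on `2^n * volume W` uniform in `n`.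
  have key : ∀ n : ℕ, ∃ D ⊆ W, IsOpen D ∧ D ⊆ Metric.closedBall (S.a i) (S.β⁻¹ ^ n * R) ∧
      volume D = 2 ^ n * (ENNReal.ofReal (S.β⁻¹ ^ d)) ^ n * volume W := by
    intro n
    induction n with
    | zero => exact ⟨W, subset_rfl, ho, by simpa using hR, by simp⟩
    | succ n ih =>
      obtain ⟨D, hDW, hDo, hDb, hDv⟩ := ih
      have hsub : ∀ l, S.Ψ l '' D ⊆ W := fun l =>
        (Set.image_mono hDW).trans ((Set.subset_iUnion (fun l => S.Ψ l '' W) l).trans hs)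
      have hball : ∀ l, S.a l = S.a i →
          S.Ψ l '' D ⊆ Metric.closedBall (S.a i) (S.β⁻¹ ^ (n + 1) * R) := by
        rintro l hl _ ⟨x, hx, rfl⟩
        have h1 := Metric.mem_closedBall.1 (hDb hx)
        rw [Metric.mem_closedBall, ← hl, ← S.Ψ_a l, dist_Ψ, hl, pow_succ']
        calc S.β⁻¹ * dist x (S.a i) ≤ S.β⁻¹ * (S.β⁻¹ ^ n * R) := by gcongr
          _ = _ := by ring
      refine ⟨S.Ψ i '' D ∪ S.Ψ j '' D, Set.union_subset (hsub i) (hsub j),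
        (hopen i D hDo).union (hopen j D hDo),
        Set.union_subset (hball i rfl) (hball j hij.symm), ?_⟩
      rw [measure_union ((hd i j hne).mono (Set.image_mono hDW) (Set.image_mono hDW))
        (hopen j D hDo).measurableSet, volume_image_Ψ, volume_image_Ψ, hDv]
      ring
  have hW0 : volume W ≠ 0 := (ho.measure_pos volume hW).ne'
  have hc0 : ENNReal.ofReal (S.β⁻¹ ^ d) ≠ 0 := by
    rw [Ne, ENNReal.ofReal_eq_zero, not_le]
    positivity
  have hle : ∀ n : ℕ,
      2 ^ n * volume W ≤ volume (Metric.closedBall (0 : EuclideanSpace ℝ (Fin d)) R) := by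
    intro n
    obtain ⟨D, -, -, hDb, hDv⟩ := key n
    have h1 := measure_mono (μ := volume) hDb
    have hpow : ENNReal.ofReal ((S.β⁻¹ ^ n) ^ d) = ENNReal.ofReal (S.β⁻¹ ^ d) ^ n := by
      rw [← ENNReal.ofReal_pow (by positivity), pow_right_comm]
    rw [hDv, Measure.addHaar_closedBall_mul _ _ (pow_nonneg hβ.le n) hR0,
      finrank_euclideanSpace_fin, hpow] at h1
    have h2 : ENNReal.ofReal (S.β⁻¹ ^ d) ^ n * (2 ^ n * volume W) ≤
        ENNReal.ofReal (S.β⁻¹ ^ d) ^ n *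
          volume (Metric.closedBall (0 : EuclideanSpace ℝ (Fin d)) R) := by
      rw [← mul_assoc, mul_comm (_ ^ n) (2 ^ n)]
      exact h1
    exact (ENNReal.mul_le_mul_iff_right (pow_ne_zero _ hc0)
      (ENNReal.pow_ne_top ENNReal.ofReal_ne_top)).1 h2
  have hfin : volume (Metric.closedBall (0 : EuclideanSpace ℝ (Fin d)) R) < ⊤ :=
    measure_closedBall_lt_top
  have htop : Tendsto (fun n : ℕ => (2 : ENNReal) ^ n * volume W) atTop (nhds ⊤) := by
    have h2 : Tendsto (fun n : ℕ => (2 : ENNReal) ^ n) atTop (nhds ⊤) :=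
      ENNReal.tendsto_pow_atTop_nhds_top_iff.2 (by norm_num)
    have := ENNReal.Tendsto.mul_const (b := volume W) h2 (Or.inl ENNReal.top_ne_zero)
    rwa [ENNReal.top_mul hW0] at this
  exact absurd (le_of_tendsto' htop hle) (not_le.2 hfin)

end Geometry

/-! ### Vertices of the unbounded graph. -/

section Vertex

variable {d N : ℕ} [NeZero N] (S : SimilitudeSystem d N)

theorem rev_cons (η : Address N) (k : Fin N) (n : ℕ) (x : EuclideanSpace ℝ (Fin d)) :
    S.rev (η.cons k).1 (n + 1) x = S.rev η.1 n (S.Ψ k x) := by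
  induction n with
  | zero => rfl
  | succ n ih =>
    have h : S.rev (η.cons k).1 (n + 1 + 1) x = S.Ψ (η.1 n) (S.rev (η.cons k).1 (n + 1) x) := rfl
    rw [h, ih]
    rfl

omit [NeZero N] in
theorem rev_injective (η : ℕ → Fin N) (n : ℕ) : Function.Injective (S.rev η n) := by
  induction n with
  | zero => exact Function.injective_id
  | succ n ih => exact (S.Ψ_injective _).comp ih

/-- Once the address is constantly `0`, each further factor `β` cancels the contraction, so the
sequence defining `vertex` is eventually constant. -/
theorem pow_smul_rev_eq (h0 : ∀ x, S.Ψ 0 x = S.β⁻¹ • x) {η : ℕ → Fin N} {n : ℕ}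
    (hn : ∀ k, n ≤ k → η k = 0) (m : ℕ) (hm : n ≤ m) (x : EuclideanSpace ℝ (Fin d)) :
    S.β ^ m • S.rev η m x = S.β ^ n • S.rev η n x := by
  induction m, hm using Nat.le_induction with
  | base => rfl
  | succ m hm ih =>
    rw [← ih]
    simp only [rev, Function.comp_apply, hn m hm, h0, pow_succ, mul_smul,
      smul_inv_smul₀ S.β_pos.ne']

/-- The `0`-cell with address `η` and its subdivision are the images of `V_0` and of `V_1` under
one injective map. -/
theorem exists_vertex_eq (h0 : ∀ x, S.Ψ 0 x = S.β⁻¹ • x) (η : Address N) :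
    ∃ G : EuclideanSpace ℝ (Fin d) → EuclideanSpace ℝ (Fin d), Function.Injective G ∧
      (∀ i : S.IFix, S.β • S.vertex η i = G (S.a i.1)) ∧
      ∀ k (j : S.IFix), S.vertex (η.cons k) j = G (S.Ψ k (S.a j.1)) := by
  obtain ⟨n, hn⟩ := η.2
  -- The address `η.cons k` is one entry longer than `η`, so its limit is reached at `n + 1`; the
  -- extra factor `β` accounts for this and is the magnification in the coarse cell.
  refine ⟨fun x => S.β • S.β ^ n • S.rev η.1 n x, ?_, ?_, ?_⟩
  · intro x y h
    exact S.rev_injective _ _ (smul_right_injective _ (pow_ne_zero n S.β_pos.ne')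
      (smul_right_injective _ S.β_pos.ne' h))
  · intro i
    congr 1
    refine Tendsto.limUnder_eq (tendsto_const_nhds.congr' ?_)
    filter_upwards [eventually_ge_atTop n] with m hm
    exact (S.pow_smul_rev_eq h0 hn m hm _).symm
  · intro k j
    refine Tendsto.limUnder_eq (tendsto_const_nhds.congr' ?_)
    filter_upwards [eventually_ge_atTop (n + 1)] with m hm
    obtain ⟨m, rfl⟩ := Nat.exists_eq_succ_of_ne_zero (show m ≠ 0 by omega)
    rw [Nat.succ_eq_add_one, rev_cons, ← S.pow_smul_rev_eq h0 hn m (by omega), pow_succ', mul_smul]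

end Vertex

end SimilitudeSystem

/-! ### Consequences of finite ramification. -/

namespace IsUFRFractal

variable {d N : ℕ} [NeZero N] {S : SimilitudeSystem d N} {F : Set (EuclideanSpace ℝ (Fin d))}

theorem a_injective (hF : IsUFRFractal S F) : Function.Injective S.a := by
  obtain ⟨W, h1, h2, h3, h4, h5⟩ := hF.open_set_condition
  exact S.a_injective_of_openSetCondition h1 h2 h3 h4 h5

theorem Ψ_mem (hF : IsUFRFractal S F) (i : Fin N) (x : EuclideanSpace ℝ (Fin d)) (hx : x ∈ F) :
    S.Ψ i x ∈ F := by
  rw [hF.self_similar]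
  exact Set.mem_iUnion_of_mem i ⟨x, hx, rfl⟩

theorem word_mem (hF : IsUFRFractal S F) (w : List (Fin N)) {x : EuclideanSpace ℝ (Fin d)}
    (hx : x ∈ F) : S.word w x ∈ F :=
  S.word_maps_of_Ψ_maps hF.Ψ_mem w hx

theorem a_mem (hF : IsUFRFractal S F) (i : Fin N) : S.a i ∈ F := by
  obtain ⟨x, hx⟩ := hF.nonempty
  refine hF.isCompact.isClosed.mem_of_tendsto
    ((S.contractingWith_Ψ i).tendsto_iterate_fixedPoint x) (Eventually.of_forall fun n => ?_)
  induction n with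
  | zero => exact hx
  | succ n ih =>
    rw [Function.iterate_succ_apply']
    exact hF.Ψ_mem i _ ih

theorem V₀_subset (hF : IsUFRFractal S F) : S.V₀ ⊆ F := by
  rintro x ⟨⟨i, rfl⟩, -⟩
  exact hF.a_mem i

/-- A point of `V_0` in `Ψ_w(F)` is a vertex of the cell of `w`. -/
theorem mem_V₀_of_word_mem_V₀ (hF : IsUFRFractal S F) (w : List (Fin N))
    {x : EuclideanSpace ℝ (Fin d)} (hx : x ∈ F) (h : S.word w x ∈ S.V₀) : x ∈ S.V₀ := by
  obtain ⟨i, hi⟩ := h.1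
  -- The point `a_i` lies in the cell with word `i⋯i`. Either `w` is that word, or `a_i` is common
  -- to two cells of the same level and hence a vertex of both.
  by_cases hw : w = List.replicate w.length i
  · have : x = S.a i := S.word_injective w (by
      rw [← hi]
      conv_rhs => rw [hw, S.word_replicate_a])
    rw [this, hi]
    exact h
  · have h1 : S.word w x ∈ S.word w '' F ∩ S.word (List.replicate w.length i) '' F :=
      ⟨⟨x, hx, rfl⟩, S.a i, hF.a_mem i, by rw [S.word_replicate_a, hi]⟩
    rw [hF.finitely_ramified _ _ (by simp) hw] at h1
    obtain ⟨y, hy, hyx⟩ := h1.1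
    exact S.word_injective w hyx ▸ hy

theorem mem_V₀_of_word_eq_word (hF : IsUFRFractal S F) {w w' : List (Fin N)}
    (hl : w.length = w'.length) (hne : w ≠ w') {x y : EuclideanSpace ℝ (Fin d)} (hx : x ∈ F)
    (hy : y ∈ F) (h : S.word w x = S.word w' y) : x ∈ S.V₀ ∧ y ∈ S.V₀ := by
  have h1 : S.word w x ∈ S.word w '' F ∩ S.word w' '' F := ⟨⟨x, hx, rfl⟩, y, hy, h.symm⟩
  rw [hF.finitely_ramified w w' hl hne] at h1
  obtain ⟨⟨x', hx', hxx⟩, ⟨y', hy', hyy⟩⟩ := h1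
  rw [h] at hyy
  exact ⟨S.word_injective w hxx ▸ hx', S.word_injective w' hyy ▸ hy'⟩

/-- Ensures that boundary values on a cell can be prescribed independently. -/
theorem vertex_injective (hF : IsUFRFractal S F) (η : Address N) :
    Function.Injective (S.vertex η) := by
  obtain ⟨G, hG, h1, -⟩ := S.exists_vertex_eq hF.Ψ_zero η
  intro i j hij
  have := h1 i
  rw [hij, h1 j] at this
  exact Subtype.ext (hF.a_injective (hG this)).symm

end IsUFRFractal

/-! ### Minimising a quadratic energy under linear constraints. -/

/-- The infimum of `‖L v‖²` over the functions `v` with prescribed values `ξ` at finitely many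
points is attained, and it is the squared norm of a linear function of `ξ`. -/
theorem exists_linearMap_isLeast_norm_sq {X I H : Type*} [NormedAddCommGroup H]
    [InnerProductSpace ℝ H] [FiniteDimensional ℝ H] (L : (X → ℝ) →ₗ[ℝ] H) {p : I → X}
    (hp : Function.Injective p) :
    ∃ T : (I → ℝ) →ₗ[ℝ] H, ∀ ξ : I → ℝ,
      IsLeast ((fun v => ‖L v‖ ^ 2) '' {v : X → ℝ | ∀ i, v (p i) = ξ i}) (‖T ξ‖ ^ 2) := by
  let W : Submodule ℝ (X → ℝ) := LinearMap.ker (LinearMap.funLeft ℝ ℝ p)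
  have hW : ∀ v, v ∈ W ↔ ∀ i, v (p i) = 0 := fun v => by
    rw [LinearMap.mem_ker, funext_iff]
    rfl
  let K : Submodule ℝ H := W.map L
  let e := Function.ExtendByZero.linearMap ℝ p
  have he : ∀ ξ i, e ξ (p i) = ξ i := fun ξ i => hp.extend_apply ξ 0 i
  -- The admissible `v` form the coset `e ξ + W`, whose image is `L (e ξ) + K`; its element of least
  -- norm is the component of `L (e ξ)` orthogonal to `K`.
  refine ⟨Kᗮ.starProjection.toLinearMap ∘ₗ L ∘ₗ e, fun ξ => ⟨?_, ?_⟩⟩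
  · obtain ⟨w, hw, hwK⟩ : K.starProjection (L (e ξ)) ∈ K := Submodule.starProjection_apply_mem _ _
    refine ⟨e ξ - w, fun i => ?_, ?_⟩
    · rw [Pi.sub_apply, he, (hW w).1 hw i, sub_zero]
    · have : L (e ξ - w) = Kᗮ.starProjection (L (e ξ)) := by
        rw [map_sub, hwK, Submodule.starProjection_orthogonal_val]
      simp only [this]
      rfl
  · rintro _ ⟨v, hv, rfl⟩
    have h1 : L (v - e ξ) ∈ K := Submodule.mem_map_of_mem ((hW _).2 fun i => by
      rw [Pi.sub_apply, he, hv i, sub_self])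
    have h2 : Kᗮ.starProjection (L v) = Kᗮ.starProjection (L (e ξ)) := by
      rw [← sub_eq_zero, ← map_sub, ← map_sub]
      exact Submodule.starProjection_orthogonal_apply_eq_zero h1
    have h3 : ‖Kᗮ.starProjection (L (e ξ))‖ ≤ ‖L v‖ := by
      rw [← h2]
      exact Submodule.norm_starProjection_apply_le _ _
    exact pow_le_pow_left₀ (norm_nonneg _) h3 2

namespace SimilitudeSystem

/-! ### Quadratic forms of networks. -/

section Form

variable {d N : ℕ} (S : SimilitudeSystem d N)

theorem form_eq_sum_sq {Q : S.IFix → S.IFix → ℝ} (hQ : S.IsQ Q) (ξ : S.IFix → ℝ) :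
    S.form Q ξ = ∑ i, ∑ j, Q i j / 2 * (ξ i - ξ j) ^ 2 := by
  have h1 : ∑ i, ∑ j, Q i j * ξ i ^ 2 = 0 := by
    simp_rw [← Finset.sum_mul, hQ.2, zero_mul, Finset.sum_const_zero]
  have h2 : ∑ i, ∑ j, Q i j * ξ j ^ 2 = 0 := by
    rw [Finset.sum_comm]
    refine Finset.sum_eq_zero fun j _ => ?_
    rw [← Finset.sum_mul, Finset.sum_congr rfl fun i _ => hQ.1 i j, hQ.2, zero_mul]
  have h3 : ∀ i j, Q i j / 2 * (ξ i - ξ j) ^ 2 =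
      (1 / 2) * (Q i j * ξ i ^ 2) + (1 / 2) * (Q i j * ξ j ^ 2) - Q i j * ξ i * ξ j := by
    intro i j
    ring
  simp only [h3, Finset.sum_sub_distrib, Finset.sum_add_distrib, ← Finset.mul_sum, h1, h2, form]
  ring

theorem form_nonneg {Q : S.IFix → S.IFix → ℝ} (hQ : S.IsQM Q) (ξ : S.IFix → ℝ) :
    0 ≤ S.form Q ξ := by
  rw [S.form_eq_sum_sq hQ.1]
  refine Finset.sum_nonneg fun i _ => Finset.sum_nonneg fun j _ => ?_
  by_cases hij : i = j
  · simp [hij]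
  · have := hQ.2 i j hij
    positivity

theorem form_abs_le {Q : S.IFix → S.IFix → ℝ} (hQ : S.IsQM Q) (ξ : S.IFix → ℝ) :
    S.form Q (fun i => |ξ i|) ≤ S.form Q ξ := by
  rw [S.form_eq_sum_sq hQ.1, S.form_eq_sum_sq hQ.1]
  refine Finset.sum_le_sum fun i _ => Finset.sum_le_sum fun j _ => ?_
  by_cases hij : i = j
  · simp [hij]
  · have := hQ.2 i j hij
    exact mul_le_mul_of_nonneg_left (sq_le_sq.2 (abs_abs_sub_abs_le _ _)) (by positivity)

/-- Polarisation: the values at `t = 1` and `t = -1` differ by a multiple of `Q i j`, which gives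
both its sign and its measurability. -/
theorem form_pair {Q : S.IFix → S.IFix → ℝ} (hQ : S.IsQ Q) {i j : S.IFix} (hij : i ≠ j) (t : ℝ) :
    S.form Q (fun l => if l = i then 1 else if l = j then t else 0) =
      -(Q i i + 2 * t * Q i j + t ^ 2 * Q j j) := by
  have h : ∀ f : S.IFix → ℝ, ∑ l, f l * (if l = i then 1 else if l = j then t else 0) =
      f i + f j * t := by
    intro f
    rw [← Finset.sum_subset (Finset.subset_univ {i, j}) (by
      intro l _ hl
      simp only [Finset.mem_insert, Finset.mem_singleton, not_or] at hl
      simp [hl.1, hl.2]), Finset.sum_pair hij]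
    simp [hij.symm]
  simp only [form, h]
  simp only [Finset.sum_add_distrib, ← Finset.sum_mul, h, hQ.1 j i]
  ring

/-- The energy of an indicator is the total conductance across the cut. The edge between `i` and `j`
occurs in both orders with weight `1/2`. -/
theorem apply_le_form_indicator {Q : S.IFix → S.IFix → ℝ} (hQ : S.IsQM Q) {A : Set S.IFix}
    {i j : S.IFix} (hi : i ∈ A) (hj : j ∉ A) :
    Q i j ≤ S.form Q (A.indicator 1) := by
  have hij : i ≠ j := fun h => hj (h ▸ hi)
  rw [S.form_eq_sum_sq hQ.1, ← Finset.sum_product']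
  have h0 : ∀ e : S.IFix × S.IFix,
      0 ≤ Q e.1 e.2 / 2 * (A.indicator 1 e.1 - A.indicator 1 e.2 : ℝ) ^ 2 := by
    rintro ⟨k, l⟩
    by_cases hkl : k = l
    · simp [hkl]
    · have := hQ.2 k l hkl
      positivity
  calc Q i j = ∑ e ∈ ({(i, j), (j, i)} : Finset (S.IFix × S.IFix)),
        Q e.1 e.2 / 2 * (A.indicator 1 e.1 - A.indicator 1 e.2 : ℝ) ^ 2 := by
        rw [Finset.sum_pair (by simp [hij])]
        simp [hi, hj, hQ.1.1 j i]
    _ ≤ _ := Finset.sum_le_sum_of_subset_of_nonneg (by simp) fun e _ _ => h0 e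

end Form

/-! ### One renormalisation step. -/

section Renorm

variable {d N : ℕ} [NeZero N] (S : SimilitudeSystem d N)

theorem bddBelow_renormEnergy {θ : Address N → S.IFix → S.IFix → ℝ} (hθ : ∀ η, S.IsQM (θ η))
    (η : Address N) (ξ : S.IFix → ℝ) :
    BddBelow (Set.range fun v : {v : EuclideanSpace ℝ (Fin d) → ℝ //
      ∀ i, v (S.β • S.vertex η i) = ξ i} =>
        ∑ k : Fin N, S.form (θ (η.cons k)) fun j => v.1 (S.vertex (η.cons k) j)) :=
  ⟨0, by
    rintro _ ⟨v, rfl⟩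
    exact Finset.sum_nonneg fun k _ => S.form_nonneg (hθ _) _⟩

theorem renormEnergy_le {θ : Address N → S.IFix → S.IFix → ℝ} (hθ : ∀ η, S.IsQM (θ η))
    {η : Address N} {ξ : S.IFix → ℝ} (v : EuclideanSpace ℝ (Fin d) → ℝ)
    (hv : ∀ i, v (S.β • S.vertex η i) = ξ i) :
    S.renormEnergy θ η ξ ≤
      ∑ k : Fin N, S.form (θ (η.cons k)) fun j => v (S.vertex (η.cons k) j) :=
  ciInf_le (S.bddBelow_renormEnergy hθ η ξ) ⟨v, hv⟩

/-- The energy is a squared norm `‖L v‖²`, so its constrained minimum is `‖T ξ‖²` with `T` linear,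
hence quadratic in `ξ`. Constants have no energy, which makes the row sums vanish. Thus `renorm`
never takes its default value `0` here. -/
theorem exists_form_eq_renormEnergy {θ : Address N → S.IFix → S.IFix → ℝ}
    (hθ : ∀ η, S.IsQM (θ η)) {η : Address N} (hη : Function.Injective (S.vertex η)) :
    ∃ Q, S.IsQ Q ∧ ∀ ξ, S.form Q ξ = S.renormEnergy θ η ξ := by
  let L : (EuclideanSpace ℝ (Fin d) → ℝ) →ₗ[ℝ] EuclideanSpace ℝ (Fin N × S.IFix × S.IFix) :=
    { toFun := fun v => WithLp.toLp 2 fun e => √(θ (η.cons e.1) e.2.1 e.2.2 / 2) *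
        (v (S.vertex (η.cons e.1) e.2.1) - v (S.vertex (η.cons e.1) e.2.2))
      map_add' := fun v w => by
        ext e
        simp only [Pi.add_apply, PiLp.add_apply]
        ring
      map_smul' := fun t v => by
        ext e
        simp only [Pi.smul_apply, PiLp.smul_apply, smul_eq_mul, RingHom.id_apply]
        ring }
  have hL : ∀ v, ‖L v‖ ^ 2 =
      ∑ k : Fin N, S.form (θ (η.cons k)) fun j => v (S.vertex (η.cons k) j) := by
    intro v
    rw [EuclideanSpace.norm_sq_eq, Fintype.sum_prod_type]
    refine Finset.sum_congr rfl fun k _ => ?_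
    rw [S.form_eq_sum_sq (hθ _).1, Fintype.sum_prod_type]
    refine Finset.sum_congr rfl fun i _ => Finset.sum_congr rfl fun j _ => ?_
    simp only [L, LinearMap.coe_mk, AddHom.coe_mk, Real.norm_eq_abs, sq_abs, mul_pow]
    by_cases hij : i = j
    · simp [hij]
    · rw [Real.sq_sqrt (div_nonneg ((hθ _).2 i j hij) zero_le_two)]
  have hp : Function.Injective fun i => S.β • S.vertex η i :=
    (smul_right_injective _ S.β_pos.ne').comp hη
  obtain ⟨T, hT⟩ := exists_linearMap_isLeast_norm_sq L hp
  have hE : ∀ ξ, S.renormEnergy θ η ξ = ‖T ξ‖ ^ 2 := by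
    intro ξ
    obtain ⟨⟨v, hv, hvT⟩, hle⟩ := hT ξ
    refine le_antisymm ?_ ?_
    · rw [← hvT]
      simp only [hL]
      exact S.renormEnergy_le hθ v hv
    · have : Nonempty {v : EuclideanSpace ℝ (Fin d) → ℝ //
        ∀ i, v (S.β • S.vertex η i) = ξ i} := ⟨⟨v, hv⟩⟩
      refine le_ciInf fun w => ?_
      rw [← hL]
      exact hle ⟨w.1, w.2, rfl⟩
  have hT1 : T 1 = 0 := by
    have h := (hT 1).2 ⟨1, fun i => rfl, rfl⟩
    have h1 : L 1 = 0 := by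
      ext e
      simp [L]
    simp only [h1, norm_zero] at h
    have := norm_nonneg (T 1)
    exact norm_eq_zero.1 (by nlinarith)
  have hsum : ∀ ξ, T ξ = ∑ i, ξ i • T (Pi.single i 1) := by
    intro ξ
    conv_lhs => rw [pi_eq_sum_univ' ξ]
    rw [map_sum]
    refine Finset.sum_congr rfl fun i _ => ?_
    rw [map_smul]
  -- Minus the Gram matrix of `T`, as `form` carries a minus sign.
  refine ⟨fun i j => -inner ℝ (T (Pi.single i 1)) (T (Pi.single j 1)), ⟨?_, ?_⟩, ?_⟩
  · intro i j
    simp only [real_inner_comm]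
  · intro i
    rw [Finset.sum_neg_distrib, ← inner_sum, neg_eq_zero]
    have h := hsum 1
    simp only [Pi.one_apply, one_smul] at h
    rw [← h, hT1, inner_zero_right]
  · intro ξ
    rw [hE, ← real_inner_self_eq_norm_sq, hsum, sum_inner]
    simp only [form, inner_sum, real_inner_smul_left, real_inner_smul_right]
    rw [← Finset.sum_neg_distrib]
    refine Finset.sum_congr rfl fun i _ => ?_
    rw [← Finset.sum_neg_distrib]
    exact Finset.sum_congr rfl fun j _ => by ring

theorem isQ_renorm {θ : Address N → S.IFix → S.IFix → ℝ} (hθ : ∀ η, S.IsQM (θ η)) {η : Address N}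
    (hη : Function.Injective (S.vertex η)) : S.IsQ (S.renorm θ η) := by
  have h := S.exists_form_eq_renormEnergy hθ hη
  rw [renorm, dif_pos h]
  exact h.choose_spec.1

theorem form_renorm {θ : Address N → S.IFix → S.IFix → ℝ} (hθ : ∀ η, S.IsQM (θ η)) {η : Address N}
    (hη : Function.Injective (S.vertex η)) (ξ : S.IFix → ℝ) :
    S.form (S.renorm θ η) ξ = S.renormEnergy θ η ξ := by
  have h := S.exists_form_eq_renormEnergy hθ hη
  rw [renorm, dif_pos h]
  exact h.choose_spec.2 ξ

/-- Markov property: replacing `v` by `|v|` does not increase the energy. Comparing the boundary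
values `e_i - e_j` and `e_i + e_j` then gives `0 ≤ Q i j`. -/
theorem isQM_renorm {θ : Address N → S.IFix → S.IFix → ℝ} (hθ : ∀ η, S.IsQM (θ η)) {η : Address N}
    (hη : Function.Injective (S.vertex η)) : S.IsQM (S.renorm θ η) := by
  refine ⟨S.isQ_renorm hθ hη, fun i j hij => ?_⟩
  have habs : ∀ ξ : S.IFix → ℝ,
      S.renormEnergy θ η (fun i => |ξ i|) ≤ S.renormEnergy θ η ξ := by
    intro ξ
    have : Nonempty {v : EuclideanSpace ℝ (Fin d) → ℝ // ∀ i, v (S.β • S.vertex η i) = ξ i} :=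
      ⟨⟨Function.extend (fun i => S.β • S.vertex η i) ξ 0, fun i =>
        ((smul_right_injective _ S.β_pos.ne').comp hη).extend_apply ξ 0 i⟩⟩
    refine le_ciInf fun v => (S.renormEnergy_le hθ (fun x => |v.1 x|) fun i => ?_).trans
      (Finset.sum_le_sum fun k _ => S.form_abs_le (hθ _) _)
    rw [v.2]
  have h := habs fun l => if l = i then 1 else if l = j then -1 else 0
  have h' : (fun l => |if l = i then (1 : ℝ) else if l = j then -1 else 0|) =
      fun l => if l = i then 1 else if l = j then 1 else 0 := by
    ext l
    split_ifs <;> simp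
  rw [h', ← S.form_renorm hθ hη, ← S.form_renorm hθ hη, S.form_pair (S.isQ_renorm hθ hη) hij,
    S.form_pair (S.isQ_renorm hθ hη) hij] at h
  linarith

/-- A large conductance of the renormalised network forces a path of edges of large conductance in
the original one: otherwise the indicator of the set of points that are joined to one end by such
edges has small energy. -/
theorem exists_path_of_le_renorm {θ : Address N → S.IFix → S.IFix → ℝ} (hθ : ∀ η, S.IsQM (θ η))
    {η : Address N} (hη : Function.Injective (S.vertex η)) {i j : S.IFix} {s C : ℝ} (hs : 0 < s)
    (hC : (N * Fintype.card S.IFix ^ 2 : ℝ) ≤ C) (h : s ≤ S.renorm θ η i j) :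
    Relation.ReflTransGen (fun x y => ∃ (k : Fin N) (i' j' : S.IFix), i' ≠ j' ∧
      s / C ≤ θ (η.cons k) i' j' ∧ x = S.vertex (η.cons k) i' ∧ y = S.vertex (η.cons k) j')
      (S.β • S.vertex η i) (S.β • S.vertex η j) := by
  have hN : (0 : ℝ) < N := Nat.cast_pos.2 (NeZero.pos N)
  have hcard : (0 : ℝ) < Fintype.card S.IFix := Nat.cast_pos.2 (Fintype.card_pos_iff.2 ⟨i⟩)
  have hC0 : 0 < C := lt_of_lt_of_le (by positivity) hC
  set R : EuclideanSpace ℝ (Fin d) → EuclideanSpace ℝ (Fin d) → Prop := fun x y =>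
    ∃ (k : Fin N) (i' j' : S.IFix), i' ≠ j' ∧
      s / C ≤ θ (η.cons k) i' j' ∧ x = S.vertex (η.cons k) i' ∧ y = S.vertex (η.cons k) j' with hR
  by_contra hcon
  let A : Set (EuclideanSpace ℝ (Fin d)) := {x | Relation.ReflTransGen R (S.β • S.vertex η i) x}
  have hle : S.renorm θ η i j ≤
      ∑ k : Fin N, S.form (θ (η.cons k)) fun l => A.indicator 1 (S.vertex (η.cons k) l) := by
    refine (S.apply_le_form_indicator (A := {l | S.β • S.vertex η l ∈ A}) (S.isQM_renorm hθ hη)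
      Relation.ReflTransGen.refl hcon).trans ?_
    rw [S.form_renorm hθ hη]
    exact S.renormEnergy_le hθ _ fun l => rfl
  -- Edges of large conductance do not leave `A`, and any other ordered pair contributes at most `s
  -- / (2C)`. The factor `1/2` leaves a total of at most `s / 2`, strictly below `s`.
  have hlt : ∀ k : Fin N, S.form (θ (η.cons k)) (fun l => A.indicator 1 (S.vertex (η.cons k) l)) ≤
      Fintype.card S.IFix ^ 2 * (s / C / 2) := by
    intro k
    rw [S.form_eq_sum_sq (hθ _).1, sq, mul_assoc]
    refine (Finset.sum_le_card_nsmul _ _ (Fintype.card S.IFix * (s / C / 2)) fun i' _ => ?_).trans_eq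
      (by rw [nsmul_eq_mul]; rfl)
    refine (Finset.sum_le_card_nsmul _ _ (s / C / 2) fun j' _ => ?_).trans_eq
      (by rw [nsmul_eq_mul]; rfl)
    have hsC : 0 ≤ s / C / 2 := by positivity
    by_cases hij : i' = j'
    · simp [hij, hsC]
    by_cases hbig : s / C ≤ θ (η.cons k) i' j'
    · have h1 : S.vertex (η.cons k) i' ∈ A ↔ S.vertex (η.cons k) j' ∈ A :=
        ⟨fun h => h.tail ⟨k, i', j', hij, hbig, rfl, rfl⟩,
          fun h => h.tail ⟨k, j', i', Ne.symm hij, (hθ _).1.1 i' j' ▸ hbig, rfl, rfl⟩⟩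
      have h2 : A.indicator (1 : EuclideanSpace ℝ (Fin d) → ℝ) (S.vertex (η.cons k) i') =
          A.indicator 1 (S.vertex (η.cons k) j') := by
        simp only [Set.indicator_apply, h1, Pi.one_apply]
      rw [h2, sub_self]
      simpa using hsC
    · have h1 : (A.indicator 1 (S.vertex (η.cons k) i') -
          A.indicator 1 (S.vertex (η.cons k) j') : ℝ) ^ 2 ≤ 1 := by
        simp only [Set.indicator_apply, Pi.one_apply]
        split_ifs <;> norm_num
      have h0 := (hθ (η.cons k)).2 i' j' hij
      calc _ ≤ θ (η.cons k) i' j' / 2 * 1 := by gcongr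
        _ ≤ s / C / 2 := by linarith
  have hsum := hle.trans (Finset.sum_le_sum fun k _ => hlt k)
  rw [Finset.sum_const, Finset.card_univ, Fintype.card_fin, nsmul_eq_mul] at hsum
  have h3 : (N * Fintype.card S.IFix ^ 2 : ℝ) * (s / C) ≤ s := by
    rw [mul_div_left_comm]
    exact mul_le_of_le_one_right hs.le ((div_le_one hC0).2 hC)
  nlinarith

end Renorm

end SimilitudeSystem

namespace SimilitudeSystem

/-! ### Iterated renormalisation: measurability and paths. -/

section Iterate

variable {d N : ℕ} (S : SimilitudeSystem d N)

theorem IsQ.apply_self {S : SimilitudeSystem d N} {Q : S.IFix → S.IFix → ℝ} (hQ : S.IsQ Q)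
    (i : S.IFix) : Q i i = -∑ j ∈ Finset.univ.erase i, Q i j := by
  have h := hQ.2 i
  rw [← Finset.add_sum_erase _ _ (Finset.mem_univ i)] at h
  linarith

theorem IsQM.smul {S : SimilitudeSystem d N} {Q : S.IFix → S.IFix → ℝ} (hQ : S.IsQM Q) {r : ℝ}
    (hr : 0 ≤ r) : S.IsQM (r • Q) := by
  refine ⟨⟨fun i j => ?_, fun i => ?_⟩, fun i j hij => mul_nonneg hr (hQ.2 i j hij)⟩
  · simp only [Pi.smul_apply, hQ.1.1 i j]
  · simp only [Pi.smul_apply, ← Finset.smul_sum, hQ.1.2 i, smul_zero]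

variable [NeZero N]

theorem isQM_iterate_scaledRenorm (hinj : ∀ η, Function.Injective (S.vertex η)) {ϱ : ℝ}
    (hϱ : 0 ≤ ϱ) {θ : Address N → S.IFix → S.IFix → ℝ} (hθ : ∀ η, S.IsQM (θ η)) (n : ℕ)
    (η : Address N) : S.IsQM ((S.scaledRenorm ϱ)^[n] θ η) := by
  induction n generalizing η with
  | zero => exact hθ η
  | succ n ih =>
    rw [Function.iterate_succ_apply']
    exact (S.isQM_renorm ih (hinj η)).smul hϱ

/-- The infimum runs over an uncountable family, but an infimum of continuous functions of the
conductances is upper semicontinuous. -/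
theorem measurable_renormEnergy {Ω : Type*} [MeasurableSpace Ω]
    {θ : Ω → Address N → S.IFix → S.IFix → ℝ} (hθ : ∀ ω η, S.IsQM (θ ω η))
    (hm : ∀ η, Measurable fun ω => θ ω η) (η : Address N) (ξ : S.IFix → ℝ) :
    Measurable fun ω => S.renormEnergy (θ ω) η ξ := by
  -- The absolute values keep the family bounded below at all matrices, not only at those in `𝒬_M`.
  let f : {v : EuclideanSpace ℝ (Fin d) → ℝ // ∀ i, v (S.β • S.vertex η i) = ξ i} →
      (Fin N → S.IFix → S.IFix → ℝ) → ℝ := fun v M => ∑ k, ∑ i, ∑ j, |M k i j| / 2 *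
        (v.1 (S.vertex (η.cons k) i) - v.1 (S.vertex (η.cons k) j)) ^ 2
  have hf : UpperSemicontinuous fun M => ⨅ v, f v M := by
    refine upperSemicontinuous_ciInf (fun M => ⟨0, ?_⟩) fun v => Continuous.upperSemicontinuous ?_
    · rintro _ ⟨v, rfl⟩
      positivity
    · fun_prop
  have h : (fun ω => S.renormEnergy (θ ω) η ξ) =
      (fun M => ⨅ v, f v M) ∘ fun ω k => θ ω (η.cons k) := by
    ext ω
    refine iInf_congr fun v => Finset.sum_congr rfl fun k _ => ?_
    rw [S.form_eq_sum_sq (hθ _ _).1]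
    refine Finset.sum_congr rfl fun i _ => Finset.sum_congr rfl fun j _ => ?_
    by_cases hij : i = j
    · simp [hij]
    · rw [abs_of_nonneg ((hθ _ _).2 i j hij)]
  rw [h]
  exact hf.measurable.comp (measurable_pi_lambda _ fun k => hm _)

theorem measurable_renorm (hinj : ∀ η, Function.Injective (S.vertex η)) {Ω : Type*}
    [MeasurableSpace Ω] {θ : Ω → Address N → S.IFix → S.IFix → ℝ} (hθ : ∀ ω η, S.IsQM (θ ω η))
    (hm : ∀ η, Measurable fun ω => θ ω η) (η : Address N) :
    Measurable fun ω => S.renorm (θ ω) η := by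
  have hoff : ∀ i j, i ≠ j → Measurable fun ω => S.renorm (θ ω) η i j := by
    intro i j hij
    have h : (fun ω => S.renorm (θ ω) η i j) = fun ω =>
        (S.renormEnergy (θ ω) η (fun l => if l = i then 1 else if l = j then -1 else 0) -
          S.renormEnergy (θ ω) η (fun l => if l = i then 1 else if l = j then 1 else 0)) / 4 := by
      ext ω
      rw [← S.form_renorm (hθ ω) (hinj η), ← S.form_renorm (hθ ω) (hinj η),
        S.form_pair (S.isQ_renorm (hθ ω) (hinj η)) hij,
        S.form_pair (S.isQ_renorm (hθ ω) (hinj η)) hij]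
      ring
    rw [h]
    exact ((S.measurable_renormEnergy hθ hm η _).sub
      (S.measurable_renormEnergy hθ hm η _)).div_const 4
  refine measurable_pi_lambda _ fun i => measurable_pi_lambda _ fun j => ?_
  by_cases hij : i = j
  · subst hij
    simp_rw [fun ω => (S.isQ_renorm (hθ ω) (hinj η)).apply_self i]
    exact (Finset.measurable_fun_sum _ fun j hj => hoff i j (Finset.ne_of_mem_erase hj).symm).neg
  · exact hoff i j hij

theorem measurable_iterate_scaledRenorm (hinj : ∀ η, Function.Injective (S.vertex η)) {ϱ : ℝ}
    (hϱ : 0 ≤ ϱ) {Ω : Type*} [MeasurableSpace Ω] {θ : Ω → Address N → S.IFix → S.IFix → ℝ}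
    (hθ : ∀ ω η, S.IsQM (θ ω η)) (hm : ∀ η, Measurable fun ω => θ ω η) (n : ℕ) (η : Address N) :
    Measurable fun ω => (S.scaledRenorm ϱ)^[n] (θ ω) η := by
  induction n generalizing η with
  | zero => exact hm η
  | succ n ih =>
    simp_rw [Function.iterate_succ_apply']
    exact (S.measurable_renorm hinj
      (fun ω => S.isQM_iterate_scaledRenorm hinj hϱ (hθ ω) n) ih η).const_smul ϱ

/-- Two vertices of the cell of some word `w` of length `m` are joined by an edge of the network
if the conductance of that edge, in the network with cell addresses below `η`, is at least `t`. -/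
def LargeEdge (θ : Address N → S.IFix → S.IFix → ℝ) (m : ℕ) (η : Address N) (t : ℝ)
    (x y : EuclideanSpace ℝ (Fin d)) : Prop :=
  ∃ w : List (Fin N), w.length = m ∧ ∃ i j : S.IFix, i ≠ j ∧
    t ≤ θ (w.foldl Address.cons η) i j ∧ x = S.word w (S.a i.1) ∧ y = S.word w (S.a j.1)

/-- By injectivity of `G`, the preimages of consecutive edges share their common endpoint. -/
theorem _root_.Relation.ReflTransGen.of_image {X Y : Type*} {G : X → Y} (hG : Function.Injective G)
    {R : Y → Y → Prop} {R' : X → X → Prop}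
    (h : ∀ u v, R u v → ∃ x y, u = G x ∧ v = G y ∧ R' x y) {x y : X}
    (hxy : Relation.ReflTransGen R (G x) (G y)) : Relation.ReflTransGen R' x y := by
  have key : ∀ z, Relation.ReflTransGen R (G x) z →
      ∃ z', z = G z' ∧ Relation.ReflTransGen R' x z' := by
    intro z hz
    induction hz with
    | refl => exact ⟨x, rfl, .refl⟩
    | tail _ hR ih =>
      obtain ⟨z', rfl, hz'⟩ := ih
      obtain ⟨x', y', h1, rfl, h2⟩ := h _ _ hR
      exact ⟨y', rfl, hz'.tail (hG h1 ▸ h2)⟩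
  obtain ⟨z', h1, h2⟩ := key _ hxy
  exact hG h1 ▸ h2

/-- A large conductance of the `m`-fold renormalised network forces a path of edges of large
conductance in the original one. -/
theorem exists_path_of_le_iterate (h0 : ∀ x, S.Ψ 0 x = S.β⁻¹ • x)
    (hinj : ∀ η, Function.Injective (S.vertex η)) {ϱ : ℝ} (hϱ : 0 < ϱ)
    {θ : Address N → S.IFix → S.IFix → ℝ} (hθ : ∀ η, S.IsQM (θ η)) {C : ℝ} (hC0 : 0 < C)
    (hC : (N * Fintype.card S.IFix ^ 2 : ℝ) ≤ C) (m : ℕ) {η : Address N} {i j : S.IFix}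
    (hij : i ≠ j) {s : ℝ} (hs : 0 < s) (h : s ≤ (S.scaledRenorm ϱ)^[m] θ η i j) :
    Relation.ReflTransGen (S.LargeEdge θ m η (s / (ϱ * C) ^ m)) (S.a i.1) (S.a j.1) := by
  induction m generalizing η i j s with
  | zero => exact .single ⟨[], rfl, i, j, hij, by simpa using h, rfl, rfl⟩
  | succ m ih =>
    rw [Function.iterate_succ_apply'] at h
    have h1 : s / ϱ ≤ S.renorm ((S.scaledRenorm ϱ)^[m] θ) η i j := by
      rw [div_le_iff₀' hϱ]
      exact h
    have hpath := S.exists_path_of_le_renorm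
      (S.isQM_iterate_scaledRenorm hinj hϱ.le hθ m) (hinj η) (div_pos hs hϱ) hC h1
    obtain ⟨G, hG, hG1, hG2⟩ := S.exists_vertex_eq h0 η
    rw [hG1, hG1] at hpath
    have hpath' := Relation.ReflTransGen.of_image hG (R' := fun x y => ∃ (k : Fin N) (i' j' : S.IFix),
      i' ≠ j' ∧ s / ϱ / C ≤ (S.scaledRenorm ϱ)^[m] θ (η.cons k) i' j' ∧
        x = S.Ψ k (S.a i'.1) ∧ y = S.Ψ k (S.a j'.1)) (by
      rintro u v ⟨k, i', j', hne, hle, rfl, rfl⟩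
      exact ⟨_, _, hG2 k i', hG2 k j', k, i', j', hne, hle, rfl, rfl⟩) hpath
    refine hpath'.lift' id ?_
    rintro _ _ ⟨k, i', j', hne, hle, rfl, rfl⟩
    refine (ih hne (by positivity) hle).lift (S.Ψ k) ?_
    rintro _ _ ⟨w, hw, i₁, j₁, hne₁, hle₁, rfl, rfl⟩
    -- The outermost letter `k` is prepended to `η` first, so the last letter of the word becomes
    -- the first entry of the address.
    refine ⟨k :: w, by simp [hw], i₁, j₁, hne₁, ?_, rfl, rfl⟩
    rw [List.foldl_cons]
    refine le_trans (le_of_eq ?_) hle₁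
    rw [pow_succ', div_div, div_div, mul_assoc]

/-- Guarantees that distinct cells of the same level have distinct addresses, hence independent
conductances. -/
theorem _root_.Address.foldl_cons_injective {η η' : Address N} {w w' : List (Fin N)}
    (hl : w.length = w'.length) (h : w.foldl Address.cons η = w'.foldl Address.cons η') : η = η' ∧ w = w' := by
  induction w generalizing η η' w' with
  | nil =>
    obtain rfl := List.length_eq_zero_iff.1 hl.symm
    exact ⟨h, rfl⟩
  | cons k w ih =>
    cases w' with
    | nil => simp at hl
    | cons k' w' =>
      obtain ⟨h1, rfl⟩ := ih (w' := w') (Nat.succ.inj hl) h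
      have h2 : ∀ n, (η.cons k).1 n = (η'.cons k').1 n := fun n => by rw [h1]
      have hk : k = k' := h2 0
      exact ⟨Subtype.ext (funext fun n => h2 (n + 1)), by rw [hk]⟩

end Iterate

end SimilitudeSystem

namespace SimilitudeSystem

/-! ### Counting the cells in a chain. -/

section Cells

variable {d N : ℕ} (S : SimilitudeSystem d N)

/-- `x` and `y` are vertices of the cell of a common word in `B`. -/
def CellStep (B : Set (List (Fin N))) (x y : EuclideanSpace ℝ (Fin d)) : Prop :=
  ∃ w ∈ B, x ∈ S.word w '' S.V₀ ∧ y ∈ S.word w '' S.V₀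

/-- The points are joined by a chain of cells with words in `B`. -/
def CellJoined (B : Set (List (Fin N))) :
    EuclideanSpace ℝ (Fin d) → EuclideanSpace ℝ (Fin d) → Prop :=
  Relation.ReflTransGen (S.CellStep B)

/-- The words `w'` for which `w ++ w'` belongs to `B`. -/
def suffixes (B : Set (List (Fin N))) (w : List (Fin N)) : Set (List (Fin N)) :=
  {w' | w ++ w' ∈ B}

end Cells

end SimilitudeSystem

namespace IsUFRFractal

open SimilitudeSystem

variable {d N : ℕ} [NeZero N] {S : SimilitudeSystem d N} {F : Set (EuclideanSpace ℝ (Fin d))}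

/-- A chain of `(n + m)`-cells between vertices of `V_0` induces a chain of those `n`-cells that it
crosses. -/
theorem cellJoined_coarse (hF : IsUFRFractal S F) {n : ℕ} {B : Set (List (Fin N))}
    (hB : ∀ w ∈ B, n ≤ w.length) {x y : EuclideanSpace ℝ (Fin d)} (hx : x ∈ S.V₀) (hy : y ∈ S.V₀)
    (h : S.CellJoined B x y) :
    S.CellJoined {u | u.length = n ∧ ∃ p ∈ S.V₀, ∃ q ∈ S.V₀, p ≠ q ∧
      S.CellJoined (suffixes B u) p q} x y := by
  set B' := {u : List (Fin N) | u.length = n ∧ ∃ p ∈ S.V₀, ∃ q ∈ S.V₀, p ≠ q ∧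
      S.CellJoined (suffixes B u) p q} with hB'
  have hcross : ∀ u : List (Fin N), u.length = n → ∀ p ∈ S.V₀, ∀ q ∈ S.V₀,
      S.CellJoined (suffixes B u) p q → S.CellJoined B' x (S.word u p) →
        S.CellJoined B' x (S.word u q) := by
    intro u hu p hp q hq hpq hxp
    by_cases hne : p = q
    · exact hne ▸ hxp
    · exact hxp.tail ⟨u, ⟨hu, p, hp, q, hq, hne, hpq⟩, ⟨p, hp, rfl⟩, q, hq, rfl⟩
  -- Invariant along the chain: the current point lies in the `n`-cell of `u`, which was last
  -- entered at the vertex `Ψ_u(p)`. When the chain changes cell, the transition point is a vertex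
  -- of both cells, so the old one has been crossed between vertices or left where it was entered.
  have key : ∀ z, S.CellJoined B x z → ∃ u : List (Fin N), u.length = n ∧ ∃ p ∈ S.V₀, ∃ q ∈ F,
      z = S.word u q ∧ S.CellJoined (suffixes B u) p q ∧ S.CellJoined B' x (S.word u p) := by
    intro z hz
    induction hz with
    | refl =>
      obtain ⟨i, rfl⟩ := hx.1
      refine ⟨List.replicate n i, by simp, S.a i, hx, S.a i, hF.a_mem i,
        (S.word_replicate_a i n).symm, .refl, ?_⟩
      rw [S.word_replicate_a]
      exact .refl
    | @tail b c _ hstep ih =>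
      obtain ⟨u, hu, p, hp, q, hq, rfl, hpq, hxp⟩ := ih
      obtain ⟨w, hw, ⟨z₁, hz₁, hb⟩, z₂, hz₂, hc⟩ := hstep
      obtain ⟨u', w', rfl, hu'⟩ : ∃ u' w', u' ++ w' = w ∧ u'.length = n :=
        ⟨w.take n, w.drop n, List.take_append_drop n w, by simpa using hB w hw⟩
      rw [S.word_append] at hb hc
      have hF₁ := hF.word_mem w' (hF.V₀_subset hz₁)
      have hF₂ := hF.word_mem w' (hF.V₀_subset hz₂)
      have hstep : S.CellStep (suffixes B u') (S.word w' z₁) (S.word w' z₂) :=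
        ⟨w', hw, ⟨z₁, hz₁, rfl⟩, z₂, hz₂, rfl⟩
      by_cases huu : u' = u
      · subst huu
        have := S.word_injective _ hb
        exact ⟨u', hu, p, hp, _, hF₂, hc.symm, hpq.tail (this ▸ hstep), hxp⟩
      · obtain ⟨h1, h2⟩ := hF.mem_V₀_of_word_eq_word (hu'.trans hu.symm) huu hF₁ hq hb
        refine ⟨u', hu', _, h1, _, hF₂, hc.symm, .single hstep, ?_⟩
        rw [hb]
        exact hcross u hu p hp q h2 hpq hxp
  obtain ⟨u, hu, p, hp, q, hq, rfl, hpq, hxp⟩ := key y h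
  exact hcross u hu p hp q (hF.mem_V₀_of_word_mem_V₀ u hq hy) hpq hxp

/-- If no `n`-cell contains two vertices of `V_0`, then chains of `k n`-cells between different
vertices of `V_0` consist of at least `2 ^ k` cells. -/
theorem two_pow_le_ncard (hF : IsUFRFractal S F) {n : ℕ}
    (hn : ∀ w : List (Fin N), w.length = n → ∀ x ∈ S.V₀, ∀ y ∈ S.V₀, x ∈ S.word w '' S.V₀ →
      y ∈ S.word w '' S.V₀ → x = y) (k : ℕ) {B : Set (List (Fin N))}
    (hB : ∀ w ∈ B, w.length = k * n) {x y : EuclideanSpace ℝ (Fin d)} (hx : x ∈ S.V₀)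
    (hy : y ∈ S.V₀) (hxy : x ≠ y) (h : S.CellJoined B x y) : 2 ^ k ≤ B.ncard := by
  have hfin : ∀ (B : Set (List (Fin N))) (l : ℕ), (∀ w ∈ B, w.length = l) → B.Finite :=
    fun B l hB => (List.finite_length_eq (Fin N) l).subset hB
  induction k generalizing B x y with
  | zero =>
    rw [pow_zero, Nat.one_le_iff_ne_zero, Ne, Set.ncard_eq_zero (hfin B _ hB)]
    rintro rfl
    rcases Relation.ReflTransGen.cases_head h with rfl | ⟨z, ⟨w, hw, -⟩, -⟩
    · exact hxy rfl
    · exact hw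
  | succ k ih =>
    have hcoarse := hF.cellJoined_coarse (n := n) (fun w hw => by
      rw [hB w hw, Nat.succ_mul]; omega) hx hy h
    set B' := {u : List (Fin N) | u.length = n ∧ ∃ p ∈ S.V₀, ∃ q ∈ S.V₀, p ≠ q ∧
      S.CellJoined (suffixes B u) p q} with hB'
    have hcard : ∀ u ∈ B', 2 ^ k ≤ (suffixes B u).ncard := by
      rintro u ⟨hu, p, hp, q, hq, hpq, hj⟩
      refine ih (fun w hw => ?_) hp hq hpq hj
      have := hB _ hw
      rw [List.length_append, hu, Nat.succ_mul] at this
      omega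
    -- If only one `n`-cell were crossed, it would contain both `x` and `y`.
    have htwo : ∃ u ∈ B', ∃ u' ∈ B', u ≠ u' := by
      by_contra! hcon
      have hconst : ∀ z, S.CellJoined B' x z → z = x ∨ ∃ u ∈ B', x ∈ S.word u '' S.V₀ ∧
          z ∈ S.word u '' S.V₀ := by
        intro z hz
        induction hz with
        | refl => exact .inl rfl
        | tail _ hs ih =>
          obtain ⟨u, hu, h1, h2⟩ := hs
          rcases ih with rfl | ⟨u', hu', h3, h4⟩
          · exact .inr ⟨u, hu, h1, h2⟩
          · exact .inr ⟨u, hu, hcon u' hu' u hu ▸ h3, h2⟩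
      rcases hconst y hcoarse with rfl | ⟨u, hu, h1, h2⟩
      · exact hxy rfl
      · exact hxy (hn u hu.1 x hx y hy h1 h2)
    obtain ⟨u, hu, u', hu', hne⟩ := htwo
    have himg : ∀ v, ((v ++ ·) '' suffixes B v).ncard = (suffixes B v).ncard := fun v =>
      Set.ncard_image_of_injective _ (List.append_right_injective v)
    have hsub : (u ++ ·) '' suffixes B u ∪ (u' ++ ·) '' suffixes B u' ⊆ B := by
      rintro _ (⟨v, hv, rfl⟩ | ⟨v, hv, rfl⟩) <;> exact hv
    have hdisj : Disjoint ((u ++ ·) '' suffixes B u) ((u' ++ ·) '' suffixes B u') := by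
      rw [Set.disjoint_left]
      rintro _ ⟨v, -, rfl⟩ ⟨v', -, h⟩
      exact hne (List.append_inj_left h (hu'.1.trans hu.1.symm)).symm
    have hBf := hfin B _ hB
    calc 2 ^ (k + 1) = 2 ^ k + 2 ^ k := by ring
      _ ≤ (suffixes B u).ncard + (suffixes B u').ncard := add_le_add (hcard u hu) (hcard u' hu')
      _ = ((u ++ ·) '' suffixes B u ∪ (u' ++ ·) '' suffixes B u').ncard := by
        rw [Set.ncard_union_eq hdisj (hBf.subset (Set.subset_union_left.trans hsub))
          (hBf.subset (Set.subset_union_right.trans hsub)), himg, himg]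
      _ ≤ B.ncard := Set.ncard_le_ncard hsub hBf

end IsUFRFractal

namespace SimilitudeSystem

variable {d N : ℕ} (S : SimilitudeSystem d N)

theorem eq_of_two_le_h {n : ℕ} (hn : ∀ x ∈ S.V₀, ∀ y ∈ S.V₀, x ≠ y → 2 ≤ S.h n x y)
    (w : List (Fin N)) (hw : w.length = n) (x : EuclideanSpace ℝ (Fin d)) (hx : x ∈ S.V₀)
    (y : EuclideanSpace ℝ (Fin d)) (hy : y ∈ S.V₀) (hxw : x ∈ S.word w '' S.V₀)
    (hyw : y ∈ S.word w '' S.V₀) : x = y := by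
  by_contra hne
  have h1 : S.h n x y ≤ (1 : ℕ) := iInf₂_le 1
    ⟨le_rfl, fun _ => S.word w '' S.V₀, fun _ _ => ⟨w, hw, rfl⟩, hxw, hyw, fun i hi => by omega⟩
  have h2 := (hn x hx y hy hne).trans h1
  exact absurd h2 (by norm_num)

/-- As the diameters of the `n`-cells tend to `0`, the points of `V_0` lie in different `n`-cells
for large `n`. -/
theorem exists_two_le_h :
    ∃ n : ℕ, 1 ≤ n ∧ ∀ x ∈ S.V₀, ∀ y ∈ S.V₀, x ≠ y → 2 ≤ S.h n x y := by
  have hβ := inv_pos.2 S.β_pos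
  have hpair : ∀ p ∈ S.V₀ ×ˢ S.V₀, ∀ᶠ n : ℕ in atTop,
      p.1 ≠ p.2 → S.β⁻¹ ^ n * Metric.diam S.V₀ < dist p.1 p.2 := by
    intro p _
    by_cases hp : p.1 = p.2
    · exact Eventually.of_forall fun n h => absurd hp h
    · have ht : Tendsto (fun n : ℕ => S.β⁻¹ ^ n * Metric.diam S.V₀) atTop (nhds 0) := by
        simpa using (tendsto_pow_atTop_nhds_zero_of_lt_one hβ.le
          (inv_lt_one_of_one_lt₀ S.one_lt_β)).mul_const (Metric.diam S.V₀)
      filter_upwards [ht.eventually (gt_mem_nhds (dist_pos.2 hp))] with n hn _ using hn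
  obtain ⟨n, hn, hn1⟩ := (((Set.Finite.eventually_all (S.finite_V₀.prod S.finite_V₀)).2 hpair).and
    (eventually_ge_atTop 1)).exists
  refine ⟨n, hn1, fun x hx y hy hxy => le_iInf₂ fun k hk => ?_⟩
  obtain ⟨hk1, K, hK, hxK, hyK, -⟩ := hk
  by_contra hlt
  have hk : k = 1 := by
    have : k < 2 := by exact_mod_cast not_le.1 hlt
    omega
  subst hk
  obtain ⟨w, hw, hKw⟩ := hK 0 zero_lt_one
  rw [hKw] at hxK
  rw [show 1 - 1 = 0 from rfl, hKw] at hyK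
  obtain ⟨x', hx', rfl⟩ := hxK
  obtain ⟨y', hy', rfl⟩ := hyK
  have h1 := hn (S.word w x', S.word w y') ⟨hx, hy⟩ hxy
  simp only [S.dist_word, hw] at h1
  exact absurd h1 (not_lt.2 (mul_le_mul_of_nonneg_left
    (Metric.dist_le_diam_of_mem S.finite_V₀.isBounded hx' hy') (by positivity)))

end SimilitudeSystem

/-! ### Second moments from tail bounds. -/

/-- Layer cake formula `E[X²] = 2 ∫ t P(X ≥ t) dt`: the integrand is at most `1` on `(0, 1]` and at
most `C t^{-2}` beyond. -/
theorem memLp_two_of_measureReal_le {Ω : Type*} [MeasurableSpace Ω] {P : Measure Ω}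
    [IsProbabilityMeasure P] {X : Ω → ℝ} (hX : Measurable X) (h0 : ∀ ω, 0 ≤ X ω) {C : ℝ}
    (h : ∀ t : ℝ, 1 ≤ t → P.real {ω | t ≤ X ω} ≤ C * t ^ (-3 : ℝ)) : MemLp X 2 P := by
  rw [memLp_two_iff_integrable_sq hX.aestronglyMeasurable,
    ← lintegral_ofReal_ne_top_iff_integrable (hX.pow_const 2).aestronglyMeasurable
      (Eventually.of_forall fun ω => sq_nonneg (X ω))]
  have hlc := lintegral_rpow_eq_lintegral_meas_le_mul P (Eventually.of_forall h0) hX.aemeasurable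
    (zero_lt_two (α := ℝ))
  simp only [Real.rpow_two] at hlc
  rw [hlc]
  refine ENNReal.mul_ne_top ENNReal.ofReal_ne_top ?_
  have hsplit : Set.Ioi (0 : ℝ) = Set.Ioc 0 1 ∪ Set.Ioi 1 :=
    (Set.Ioc_union_Ioi_eq_Ioi zero_le_one).symm
  rw [hsplit]
  refine ne_top_of_le_ne_top (ENNReal.add_ne_top.2 ⟨?_, ?_⟩) (lintegral_union_le _ _ _)
  · have hle : ∫⁻ t in Set.Ioc (0 : ℝ) 1, P {ω | t ≤ X ω} * ENNReal.ofReal (t ^ (2 - 1 : ℝ)) ≤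
        ∫⁻ t in Set.Ioc (0 : ℝ) 1, 1 := by
      refine setLIntegral_mono measurable_const fun t ht => ?_
      refine mul_le_one' prob_le_one (ENNReal.ofReal_le_one.2 ?_)
      exact Real.rpow_le_one ht.1.le ht.2 (by norm_num)
    refine ne_top_of_le_ne_top ?_ hle
    simp
  · have hint : IntegrableOn (fun t : ℝ => C * t ^ (-2 : ℝ)) (Set.Ioi 1) :=
      (integrableOn_Ioi_rpow_of_lt (by norm_num) zero_lt_one).const_mul C
    have hle : ∫⁻ t in Set.Ioi (1 : ℝ), P {ω | t ≤ X ω} * ENNReal.ofReal (t ^ (2 - 1 : ℝ)) ≤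
        ∫⁻ t in Set.Ioi (1 : ℝ), ENNReal.ofReal (C * t ^ (-2 : ℝ)) := by
      refine setLIntegral_mono' measurableSet_Ioi fun t ht => ?_
      have ht0 : 0 < t := zero_lt_one.trans ht
      rw [← ofReal_measureReal, ← ENNReal.ofReal_mul measureReal_nonneg]
      refine ENNReal.ofReal_le_ofReal ?_
      calc P.real {ω | t ≤ X ω} * t ^ (2 - 1 : ℝ) ≤ C * t ^ (-3 : ℝ) * t ^ (2 - 1 : ℝ) :=
            mul_le_mul_of_nonneg_right (h t (le_of_lt ht)) (Real.rpow_nonneg ht0.le _)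
        _ = C * t ^ (-2 : ℝ) := by
            rw [mul_assoc, ← Real.rpow_add ht0]
            norm_num
    exact ne_top_of_le_ne_top hint.lintegral_lt_top.ne hle

/-- If large values of `X` require that at least `L` out of finitely many independent variables are
large, and the tails of the latter decay with exponent `g ≥ 3 / L`, then `X` has a finite second
moment. -/
theorem memLp_two_of_exists_independent_large {Ω ι E : Type*} [MeasurableSpace Ω]
    [MeasurableSpace E] {P : Measure Ω} [IsProbabilityMeasure P] {Y : ι → Ω → E}
    (hY : iIndepFun Y P) {A : ℝ → Set E} (hA : ∀ t, MeasurableSet (A t)) {c g : ℝ}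
    (htail : ∀ i t, 1 ≤ t → P.real (Y i ⁻¹' A t) ≤ c * t ^ (-g)) {X : Ω → ℝ}
    (hX : Measurable X) (h0 : ∀ ω, 0 ≤ X ω) {κ : ℝ} (hκ : 0 < κ) (D : Finset ι) {L : ℕ}
    (hL : 3 ≤ g * L) (hlarge : ∀ ω t, 0 < t → κ * t ≤ X ω →
      ∃ B ∈ D.powersetCard L, ∀ i ∈ B, Y i ω ∈ A t) : MemLp X 2 P := by
  have key : MemLp (fun ω => κ⁻¹ * X ω) 2 P := by
    refine memLp_two_of_measureReal_le (C := (D.powersetCard L).card * c ^ L)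
      (hX.const_mul κ⁻¹) (fun ω => mul_nonneg (inv_pos.2 hκ).le (h0 ω)) fun t ht => ?_
    have ht0 : 0 < t := zero_lt_one.trans_le ht
    have hsub : {ω | t ≤ κ⁻¹ * X ω} ⊆ ⋃ B ∈ D.powersetCard L, ⋂ i ∈ B, Y i ⁻¹' A t := by
      intro ω hω
      obtain ⟨B, hB, hBA⟩ := hlarge ω t ht0 ((le_inv_mul_iff₀ hκ).1 hω)
      exact Set.mem_biUnion hB (Set.mem_iInter₂.2 hBA)
    have hone : ∀ B ∈ D.powersetCard L,
        P.real (⋂ i ∈ B, Y i ⁻¹' A t) ≤ c ^ L * t ^ (-3 : ℝ) := by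
      intro B hB
      rw [measureReal_def, hY.measure_inter_preimage_eq_mul B fun i _ => hA t, ENNReal.toReal_prod]
      have hcard := (Finset.mem_powersetCard.1 hB).2
      -- The sign of `c` is read off from a tail bound at `t = 1`, which needs an index; without
      -- one, `c ^ L = 1`.
      have hc : 0 ≤ c ∨ L = 0 := by
        by_cases hL0 : L = 0
        · exact .inr hL0
        · obtain ⟨i, -⟩ := Finset.card_pos.1 (by omega : 0 < B.card)
          have := measureReal_nonneg.trans (htail i 1 le_rfl)
          exact .inl (by simpa using this)
      have hc' : 0 ≤ c ^ L := by
        rcases hc with hc | hc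
        · positivity
        · simp [hc]
      calc ∏ i ∈ B, (P (Y i ⁻¹' A t)).toReal ≤ ∏ _i ∈ B, c * t ^ (-g) :=
            Finset.prod_le_prod (fun _ _ => ENNReal.toReal_nonneg) fun i _ => htail i t ht
        _ = c ^ L * t ^ (-(g * L)) := by
            rw [Finset.prod_const, hcard, mul_pow, ← Real.rpow_natCast (t ^ (-g)),
              ← Real.rpow_mul ht0.le, neg_mul]
        _ ≤ c ^ L * t ^ (-3 : ℝ) := by
            gcongr
    calc P.real {ω | t ≤ κ⁻¹ * X ω} ≤ P.real (⋃ B ∈ D.powersetCard L, ⋂ i ∈ B, Y i ⁻¹' A t) :=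
          measureReal_mono hsub (measure_ne_top _ _)
      _ ≤ ∑ B ∈ D.powersetCard L, P.real (⋂ i ∈ B, Y i ⁻¹' A t) := measureReal_biUnion_finset_le _ _
      _ ≤ (D.powersetCard L).card • (c ^ L * t ^ (-3 : ℝ)) := Finset.sum_le_card_nsmul _ _ _ hone
      _ = _ := by rw [nsmul_eq_mul, mul_assoc]
  have := key.const_mul κ
  simpa only [mul_inv_cancel_left₀ hκ.ne'] using this

/-! ### Conclusion. -/

namespace IsUFRFractal

open SimilitudeSystem

variable {d N : ℕ} [NeZero N] {S : SimilitudeSystem d N} {F : Set (EuclideanSpace ℝ (Fin d))}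

theorem hasFiniteSecondMoments (hF : IsUFRFractal S F) {ϱ : ℝ} (hϱ : 0 < ϱ) {Ω : Type*}
    [MeasurableSpace Ω] {P : Measure Ω} [IsProbabilityMeasure P]
    {θ : Ω → Address N → S.IFix → S.IFix → ℝ} (hmem : ∀ ω η, S.IsQM (θ ω η))
    (hmeas : ∀ η, Measurable fun ω => θ ω η) (hindep : iIndepFun (fun η ω => θ ω η) P)
    {c : ℝ} (hc : 0 < c) {γ : S.IFix → S.IFix → ℝ} (hγ : ∀ i j, i ≠ j → 0 < γ i j)
    (htail : ∀ i j, i ≠ j → ∀ (η : Address N) (s : ℝ), 1 ≤ s →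
      P.real {ω | s ≤ θ ω η i j} ≤ c * s ^ (-γ i j))
    {n : ℕ} (hn1 : 1 ≤ n) (hn : ∀ x ∈ S.V₀, ∀ y ∈ S.V₀, x ≠ y → 2 ≤ S.h n x y) :
    S.HasFiniteSecondMoments P ϱ θ := by
  have hinj := hF.vertex_injective
  obtain ⟨g, hg, hgγ⟩ : ∃ g : ℝ, 0 < g ∧ ∀ i j, i ≠ j → g ≤ γ i j := by
    rcases isEmpty_or_nonempty {p : S.IFix × S.IFix // p.1 ≠ p.2} with he | he
    · exact ⟨1, one_pos, fun i j hij => (he.false ⟨(i, j), hij⟩).elim⟩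
    · obtain ⟨p, hp⟩ := Finite.exists_min
        fun p : {p : S.IFix × S.IFix // p.1 ≠ p.2} => γ p.1.1 p.1.2
      exact ⟨_, hγ _ _ p.2, fun i j hij => hp ⟨(i, j), hij⟩⟩
  -- At least `2 ^ (k + 1)` large cells will give the tail exponent `g * 2 ^ (k + 1) ≥ 3`; the shift
  -- to `k + 1` keeps `m` positive.
  obtain ⟨k, hk⟩ := pow_unbounded_of_one_lt (3 / g) (one_lt_two (α := ℝ))
  have hL : 3 ≤ g * ((2 ^ (k + 1) : ℕ) : ℝ) := by
    rw [div_lt_iff₀' hg] at hk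
    push_cast
    rw [pow_succ]
    have : (0 : ℝ) < g * 2 ^ k := by positivity
    linarith
  set m := (k + 1) * n with hm
  refine ⟨m, Nat.mul_pos k.succ_pos hn1, ?_⟩
  set C : ℝ := N * Fintype.card S.IFix ^ 2 + 1 with hC
  have hC0 : 0 < C := by positivity
  -- A cell is large if some off-diagonal entry is. One event per cell suffices, as entries of the
  -- same cell need not be independent.
  let A : ℝ → Set (S.IFix → S.IFix → ℝ) := fun t => {Q | ∃ i j, i ≠ j ∧ t ≤ Q i j}
  have hA : ∀ t, A t = ⋃ p ∈ (Finset.univ.filter fun p : S.IFix × S.IFix => p.1 ≠ p.2),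
      {Q | t ≤ Q p.1 p.2} := by
    intro t
    ext Q
    simp [A]
  have hAm : ∀ t, MeasurableSet (A t) := by
    intro t
    rw [hA]
    exact Finset.measurableSet_biUnion _ fun p _ =>
      measurableSet_le measurable_const (by fun_prop)
  have hAtail : ∀ (η : Address N) (t : ℝ), 1 ≤ t → P.real ((fun ω => θ ω η) ⁻¹' A t) ≤
      ((Finset.univ.filter fun p : S.IFix × S.IFix => p.1 ≠ p.2).card * c) * t ^ (-g) := by
    intro η t ht
    rw [hA, Set.preimage_iUnion₂, mul_assoc, ← nsmul_eq_mul]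
    refine (measureReal_biUnion_finset_le _ _).trans (Finset.sum_le_card_nsmul _ _ _ fun p hp => ?_)
    have hp := (Finset.mem_filter.1 hp).2
    refine (htail p.1 p.2 hp η t ht).trans ?_
    have := hgγ p.1 p.2 hp
    gcongr
  have hoff : ∀ i j, i ≠ j → ∀ η,
      MemLp (fun ω => (S.scaledRenorm ϱ)^[m] (θ ω) η i j) 2 P := by
    intro i j hij η
    have hX := (measurable_pi_apply j).comp ((measurable_pi_apply i).comp
      (S.measurable_iterate_scaledRenorm hinj hϱ.le hmem hmeas m η))
    refine memLp_two_of_exists_independent_large (κ := (ϱ * C) ^ m) hindep hAm hAtail hX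
      (fun ω => (S.isQM_iterate_scaledRenorm hinj hϱ.le (hmem ω) m η).2 i j hij) (by positivity)
      ((List.finite_length_eq (Fin N) m).toFinset.image fun w => w.foldl Address.cons η) hL ?_
    intro ω t ht htX
    have hκ : 0 < (ϱ * C) ^ m := by positivity
    have hpath := S.exists_path_of_le_iterate hF.Ψ_zero hinj hϱ (hmem ω) hC0 (by simp [hC]) m hij
      (mul_pos hκ ht) htX
    rw [mul_div_cancel_left₀ _ hκ.ne'] at hpath
    let B : Set (List (Fin N)) := {w | w.length = m ∧ θ ω (w.foldl Address.cons η) ∈ A t}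
    have hjoin : S.CellJoined B (S.a i.1) (S.a j.1) := by
      refine hpath.lift id ?_
      rintro _ _ ⟨w, hw, i', j', hne, hle, rfl, rfl⟩
      exact ⟨w, ⟨hw, i', j', hne, hle⟩, ⟨_, i'.2, rfl⟩, _, j'.2, rfl⟩
    have hcard := hF.two_pow_le_ncard (S.eq_of_two_le_h hn) (k + 1) (B := B) (fun w hw => hw.1)
      i.2 j.2 (fun h => hij (Subtype.ext (hF.a_injective h))) hjoin
    have hBf : B.Finite := (List.finite_length_eq (Fin N) m).subset fun w hw => hw.1
    rw [Set.ncard_eq_toFinset_card _ hBf] at hcard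
    obtain ⟨B₁, hB₁, hB₁c⟩ := Finset.exists_subset_card_eq hcard
    have hmemB : ∀ w ∈ B₁, w ∈ B := fun w hw => hBf.mem_toFinset.1 (hB₁ hw)
    refine ⟨B₁.image fun w => w.foldl Address.cons η, Finset.mem_powersetCard.2
      ⟨Finset.image_subset_image fun w hw => ?_, ?_⟩, ?_⟩
    · exact (Set.Finite.mem_toFinset _).2 (hmemB w hw).1
    · rw [Finset.card_image_of_injOn, hB₁c]
      intro w hw w' hw' h
      exact (Address.foldl_cons_injective ((hmemB w hw).1.trans (hmemB w' hw').1.symm) h).2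
    · intro η' hη'
      obtain ⟨w, hw, rfl⟩ := Finset.mem_image.1 hη'
      exact (hmemB w hw).2
  intro i j η
  by_cases hij : i = j
  · subst hij
    simp_rw [fun ω => (S.isQM_iterate_scaledRenorm hinj hϱ.le (hmem ω) m η).1.apply_self i]
    exact (memLp_finsetSum _ fun j hj => hoff i j (Finset.ne_of_mem_erase hj).symm η).neg
  · exact hoff i j hij η

end IsUFRFractal

theorem proposition6p6 {d N : ℕ} [NeZero N] (S : SimilitudeSystem d N)
    (F : Set (EuclideanSpace ℝ (Fin d))) (hF : IsUFRFractal S F)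
    -- the eigenform `Q₀` and the factor `ϱ` that normalises the renormalisation map
    (Q₀ : S.IFix → S.IFix → ℝ) (hQ₀ : S.IsIntQM Q₀) (ϱ : ℝ) (hϱ : 0 < ϱ)
    (heig : S.renormConst Q₀ = ϱ⁻¹ • Q₀)
    -- the random conductances
    {Ω : Type*} [MeasurableSpace Ω] (P : Measure Ω) [IsProbabilityMeasure P]
    (θ : Ω → Address N → S.IFix → S.IFix → ℝ) (hθ : S.IsRandomConductance P Q₀ θ)
    -- polynomial decay at infinity
    (c : ℝ) (hc : 0 < c) (γ : S.IFix → S.IFix → ℝ) (hγ : ∀ i j, i ≠ j → 0 < γ i j)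
    (htail : ∀ i j, i ≠ j → ∀ (η : Address N) (s : ℝ), 1 ≤ s →
      P.real {ω | s ≤ θ ω η i j} ≤ c * s ^ (-γ i j)) :
    ((∃ n₀ : ℕ, 1 ≤ n₀ ∧ ∀ x ∈ S.V₀, ∀ y ∈ S.V₀, x ≠ y → 2 ≤ S.h n₀ x y) →
        S.HasFiniteSecondMoments P ϱ θ) ∧
      (IsNestedFractal S F → S.HasFiniteSecondMoments P ϱ θ) := by
  have key : ∀ n, 1 ≤ n → (∀ x ∈ S.V₀, ∀ y ∈ S.V₀, x ≠ y → 2 ≤ S.h n x y) →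
      S.HasFiniteSecondMoments P ϱ θ := fun n hn1 hn =>
    hF.hasFiniteSecondMoments hϱ hθ.mem hθ.measurable hθ.indep hc hγ htail hn1 hn
  refine ⟨fun ⟨n, hn1, hn⟩ => key n hn1 hn, fun _ => ?_⟩
  obtain ⟨n, hn1, hn⟩ := S.exists_two_le_h
  exact key n hn1 hn
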